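/- Let $\Omega\subset\mathbb R^d$, $d\ge 1$, be a bounded domain, $U=H_0^1(\Omega)$ with a Hilbert inner product $(\cdot,\cdot)$ inducing the usual topology of $H_0^1(\Omega)$, and norm $\|\cdot\|$; the dual is identified with $U$ when gradients are formed. Let $p\in(0,1)$, $\alpha>0$, $\beta>0$, and let $f:U\to\mathbb R$ be Fréchet differentiable with Lipschitz continuous gradient, such that $f+\phi$ is bounded below, where $\phi(u)=\beta\int_\Omega|u|^p\,dx+\frac\alpha2\|u\|^2$. For $\epsilon>0$ put $\psi_\epsilon(t)=\frac p2\frac t{\epsilon^{2-p}}+(1-\frac p2)\epsilon^p$ for $0\le t<\epsilon^2$ and $\psi_\epsilon(t)=t^{p/2}$ for $t\ge\epsilon^2$. Given $u_k\in U$ and $\epsilon_k>0$, put $$\phi_{\epsilon_k}(u)=\beta\int_\Omega\psi_{\epsilon_k}(u^2)\,dx+\tfrac\alpha2\|u\|^2,\qquad \phi_k(u)=\beta\int_\Omega\psi_{\epsilon_k}(u_k^2)+\psi_{\epsilon_k}'(u_k^2)(u^2-u_k^2)\,dx+\tfrac\alpha2\|u\|^2,$$ and, for $r_0>0$, $p_k=\operatorname{prox}_{r_0\phi_k}(u_k-r_0\nabla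 f(u_k))$ and $h_k(u_k)=\frac1{r_0}\|p_k-u_k\|$, where $\operatorname{prox}_{r\Phi}(u)=\arg\min_v\frac1{2r}\|v-u\|^2+\Phi(v)$. **The algorithm.** Let $\epsilon_k>0$ decrease monotonically to $0$, and let $0<\eta_1<\eta_2<1$, $0<\gamma_1\le\gamma_2<1\le\gamma_3$, $\kappa_{\rm fcd},\kappa_{\rm rad}>0$, $\Delta_0>0$, $u_0\in U$. In iteration $k$ a model $m_k=f_k+\Phi_k$ with $\Phi_k\in\{\phi_k,\phi_{\epsilon_k}\}$ is chosen. Let $\omega(f_k,u_k,s)=\frac2{\|s\|^2}\left(f_k(u_k+s)-f_k(u_k)-(\nabla f_k(u_k),s)\right)$, $\omega_k=\sup\{|\omega(f_k,u_k,s)|:0<\|s\|\le\kappa_{\rm rad}\Delta_k\}$ and $h_k=\frac1{r_0}\|\operatorname{prox}_{r_0\phi_k}(u_k-r_0\nabla f_k(u_k))-u_k\|$. A trial point $t_k$ with $\|t_k-u_k\|\le\kappa_{\rm rad}\Delta_k$ is computed with $$\mathrm{pred}_k:=m_k(u_k)-m_k(t_k)\ge\kappa_{\rm fcd}\,h_k\min\left(\tfrac{h_k}{1+\omega_k},\Delta_k\right).$$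 With a computed reduction $\mathrm{cred}_k$ put $\rho_k=\mathrm{cred}_k/\mathrm{pred}_k$. If $\rho_k<\eta_1$, then $u_{k+1}=u_k$ and $\Delta_{k+1}\in[\gamma_1\Delta_k,\gamma_2\Delta_k]$; otherwise (a successful iteration) $u_{k+1}=t_k$, with $\Delta_{k+1}\in[\gamma_2\Delta_k,\Delta_k]$ if $\rho_k<\eta_2$ and $\Delta_{k+1}\in[\Delta_k,\gamma_3\Delta_k]$ if $\rho_k\ge\eta_2$. It is assumed that * each $f_k$ is differentiable with Lipschitz gradient (with a constant $L_k$), and $\|\nabla f_k(u_k)-\nabla f(u_k)\|\le\kappa_{\rm grad}\min(h_k,\Delta_k)$ for all $k$, with $\kappa_{\rm grad}\ge 0$ independent of $k$; * for $\mathrm{ared}_k=f(u_k)+\Phi_k(u_k)-f(t_k)-\Phi_k(t_k)$ one has $|\mathrm{ared}_k-\mathrm{cred}_k|\le\kappa_{\rm obj}\,(\eta\min(\mathrm{pred}_k,\theta_k))^{\zeta}$ for all $k$, for some $\kappa_{\rm obj}\ge0$, $\zeta>1$, $0<\eta<\min(\eta_1,1-\eta_2)$ and $0\le\theta_k\to0$;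 * $\sum_{k\ge1}1/b_k=\infty$ for $b_k=1+\max\{\omega_1,\dots,\omega_k\}$. **Claims.** 1. Let $(u_k)\subset U$ be any sequence and let $\epsilon_k>0$ decrease monotonically to $0$. If $u_k\rightharpoonup\bar u$ and $p_k-u_k\to0$ in $U$, then $2\int_\Omega\psi_{\epsilon_k}'(u_k^2)\,p_k^2\,dx\to p\int_\Omega|\bar u|^p\,dx$. 2. Let $(u_k)$ be generated by the algorithm under the assumptions above, with only finitely many successful iterations. Then there is $\bar u\in U$ with $u_k=\bar u$ for all large $k$, and there is $\bar\lambda\in U^*$ with $$\alpha(\bar u,v)+\beta\langle\bar\lambda,v\rangle=-f'(\bar u)v\quad\text{for all }v\in U,\qquad\langle\bar\lambda,\bar u\rangle=p\int_\Omega|\bar u|^p\,dx .$$ 3. Let $\nabla f$ be completely continuous (it maps weakly convergent sequences to strongly convergent ones, with the corresponding limit). Let $(u_k)\subset U$ be any sequence (for instance one generated by the algorithm) and let $\epsilon_k>0$ decrease monotonically to $0$. If $h_k(u_k)\to0$ along a subsequence, and $\bar u$ is the weak limit of a further subsequence of it, then there is $\bar\lambda\in U^*$ with $$\alpha(\bar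 u,v)+\beta\langle\bar\lambda,v\rangle=-f'(\bar u)v\quad\text{for all }v\in U,\qquad\langle\bar\lambda,\bar u\rangle\ge p\int_\Omega|\bar u|^p\,dx .$$ -/

import Mathlib

open Filter Topology MeasureTheory
open scoped ContDiff Gradient NNReal RealInnerProductSpace

noncomputable section

namespace SmoothedTR

/-- `ℝ^d` with the Euclidean norm. -/
abbrev Dom (d : ℕ) : Type := EuclideanSpace ℝ (Fin d)

/-! ### The space `H_0^1(Ω)` -/

/-- The ambient Hilbert space `L²(Ω) × L²(Ω; ℝ^d)` of pairs (function, gradient), with inner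
product `⟪(u, g), (v, h)⟫ = ∫_Ω u v + ∫_Ω g · h`. -/
abbrev GraphSpace {d : ℕ} (Ω : Set (Dom d)) : Type :=
  WithLp 2 (Lp ℝ 2 (volume.restrict Ω) × Lp (Dom d) 2 (volume.restrict Ω))

/-- `φ ∈ C_c^∞(Ω)`. -/
def IsTestFunction {d : ℕ} (Ω : Set (Dom d)) (φ : Dom d → ℝ) : Prop :=
  ContDiff ℝ ∞ φ ∧ HasCompactSupport φ ∧ tsupport φ ⊆ Ω

/-- The subspace `{(φ, ∇φ) : φ ∈ C_c^∞(Ω)}` of `L²(Ω) × L²(Ω; ℝ^d)`. -/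
def testGraph {d : ℕ} (Ω : Set (Dom d)) : Submodule ℝ (GraphSpace Ω) where
  carrier := {w | ∃ φ : Dom d → ℝ, IsTestFunction Ω φ ∧
    (w.fst : Dom d → ℝ) =ᵐ[volume.restrict Ω] φ ∧
    (w.snd : Dom d → Dom d) =ᵐ[volume.restrict Ω] ∇ φ}
  zero_mem' := by
    refine ⟨0, ⟨contDiff_const, HasCompactSupport.zero, by simp [tsupport]⟩, ?_, ?_⟩
    · exact Lp.coeFn_zero _ _ _
    · refine (Lp.coeFn_zero _ _ _).trans (Eventually.of_forall fun x => ?_)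
      simp only [gradient]
      rw [show (0 : Dom d → ℝ) = fun _ => 0 from rfl, fderiv_fun_const]
      simp
  add_mem' := by
    rintro a b ⟨φ, ⟨h1, h2, h3⟩, h4, h5⟩ ⟨χ, ⟨k1, k2, k3⟩, k4, k5⟩
    refine ⟨φ + χ, ⟨h1.add k1, h2.add k2, (tsupport_add φ χ).trans (Set.union_subset h3 k3)⟩,
      ?_, ?_⟩
    · exact (Lp.coeFn_add a.fst b.fst).trans (h4.add k4)
    · refine (Lp.coeFn_add a.snd b.snd).trans ?_
      filter_upwards [h5, k5] with x hx kx
      rw [Pi.add_apply, hx, kx]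
      simp only [gradient]
      rw [fderiv_add (h1.differentiable (by simp) x) (k1.differentiable (by simp) x), map_add]
  smul_mem' := by
    rintro c a ⟨φ, ⟨h1, h2, h3⟩, h4, h5⟩
    refine ⟨c • φ, ⟨h1.const_smul c, h2.mono (Function.support_const_smul_subset c φ),
      (closure_mono (Function.support_const_smul_subset c φ)).trans h3⟩, ?_, ?_⟩
    · exact (Lp.coeFn_smul c a.fst).trans (h4.const_smul c)
    · refine (Lp.coeFn_smul c a.snd).trans ?_
      filter_upwards [h5] with x hx
      rw [Pi.smul_apply, hx]
      simp only [gradient]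
      rw [fderiv_const_smul (h1.differentiable (by simp) x)]
      simp

/-- `H_0^1(Ω)`: the closure of `C_c^∞(Ω)` in the `H^1` norm. An element is the pair `(u, ∇u)` of a
function and its weak gradient; the inherited inner product is `∫_Ω u v + ∫_Ω ∇u · ∇v`. -/
abbrev H01 {d : ℕ} (Ω : Set (Dom d)) : Type := (testGraph Ω).topologicalClosure

/-- The function on `Ω` underlying an element of `H_0^1(Ω)`. -/
def H01.fn {d : ℕ} {Ω : Set (Dom d)} (u : H01 Ω) : Dom d → ℝ :=
  ((u : GraphSpace Ω).fst : Lp ℝ 2 (volume.restrict Ω))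

/-! ### The smoothed `L^p` pseudonorm -/

/-- `ψ_ε(t) = (p/2) t / ε^(2-p) + (1 - p/2) ε^p` for `t < ε²`, and `t^(p/2)` for `t ≥ ε²`. It is
only evaluated at `t ≥ 0`; as the affine branch is continued to `t < 0`, the two-sided derivative at
`0` is the one-sided derivative there. -/
def psi (p ε t : ℝ) : ℝ :=
  if t < ε ^ 2 then p / 2 * (t / ε ^ (2 - p)) + (1 - p / 2) * ε ^ p else t ^ (p / 2)

section Functionals

/- `U` is the space `H_0^1(Ω)` with a Hilbert space inner product that is equivalent to the
standard one; `e` is the identity map, regarded as an isomorphism onto `H01 Ω`. -/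
variable {d : ℕ} {Ω : Set (Dom d)} {U : Type*} [NormedAddCommGroup U] [InnerProductSpace ℝ U]
  (e : U ≃L[ℝ] H01 Ω)

/-- `∫_Ω |u|^p`. -/
def lpPseudo (p : ℝ) (u : U) : ℝ := ∫ x in Ω, |(e u).fn x| ^ p

/-- `j_ε(u) = ∫_Ω ψ_ε(u²)`. -/
def jEps (p ε : ℝ) (u : U) : ℝ := ∫ x in Ω, psi p ε ((e u).fn x ^ 2)

/-- The quadratic majorant `∫_Ω ψ_ε(w²) + ψ_ε'(w²) (u² - w²)` of `j_ε` at `w`. -/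
def jMaj (p ε : ℝ) (w u : U) : ℝ :=
  ∫ x in Ω, (psi p ε ((e w).fn x ^ 2) +
    deriv (psi p ε) ((e w).fn x ^ 2) * ((e u).fn x ^ 2 - (e w).fn x ^ 2))

/-- `φ(u) = β ∫_Ω |u|^p + (α/2) ‖u‖²`. -/
def phi (p α β : ℝ) (u : U) : ℝ := β * lpPseudo e p u + α / 2 * ‖u‖ ^ 2

/-- `φ_ε(u) = β j_ε(u) + (α/2) ‖u‖²`. -/
def phiEps (p α β ε : ℝ) (u : U) : ℝ := β * jEps e p ε u + α / 2 * ‖u‖ ^ 2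

/-- `φ_k` for `ε = ε_k` and `w = u_k`: the majorant of `φ_ε` at `w`. -/
def phiMaj (p α β ε : ℝ) (w u : U) : ℝ := β * jMaj e p ε w u + α / 2 * ‖u‖ ^ 2

end Functionals

/-! ### Proximal points, smoothness, curvature, convergence -/

section Hilbert

variable {U : Type*} [NormedAddCommGroup U] [InnerProductSpace ℝ U]

/-- `v` minimizes `‖v - u‖² / (2 r) + Φ(v)`. -/
def IsProx (r : ℝ) (Φ : U → ℝ) (u v : U) : Prop :=
  ∀ w, 1 / (2 * r) * ‖v - u‖ ^ 2 + Φ v ≤ 1 / (2 * r) * ‖w - u‖ ^ 2 + Φ w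

/-- The proximal point `prox_{rΦ}(u)`. It is only used for strongly convex continuous `Φ`, where it
exists and is unique. -/
def prox (r : ℝ) (Φ : U → ℝ) (u : U) : U := Classical.epsilon (IsProx r Φ u)

/-- `(1/r) ‖prox_{rΦ}(u - r g) - u‖`. -/
def proxResidual (r : ℝ) (Φ : U → ℝ) (g u : U) : ℝ := 1 / r * ‖prox r Φ (u - r • g) - u‖

/-- Weak convergence of a sequence. -/
def WeaklyTendsto (u : ℕ → U) (a : U) : Prop :=
  Tendsto (fun k => toWeakSpace ℝ U (u k)) atTop (𝓝 (toWeakSpace ℝ U a))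

/-- A map is completely continuous if it maps weakly convergent sequences to strongly convergent
ones. -/
def IsCompletelyContinuous (G : U → U) : Prop :=
  ∀ (u : ℕ → U) (a : U), WeaklyTendsto u a → Tendsto (fun k => G (u k)) atTop (𝓝 (G a))

variable [CompleteSpace U]

/-- `f` is Fréchet differentiable with `L`-Lipschitz continuous gradient. -/
def IsLSmooth (L : ℝ≥0) (f : U → ℝ) : Prop := Differentiable ℝ f ∧ LipschitzWith L (∇ f)

/-- The curvature `ω(f, u, s) = 2 / ‖s‖² (f(u+s) - f(u) - ⟨∇f(u), s⟩)`. -/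
def curvature (f : U → ℝ) (u s : U) : ℝ :=
  2 / ‖s‖ ^ 2 * (f (u + s) - f u - ⟪∇ f u, s⟫)

end Hilbert

/-! ### The smoothed proximal trust-region algorithm -/

/-- The parameters and the sequences that occur in a run of the algorithm. -/
structure Data (U : Type*) where
  /-- prox parameter in the definition of `h_k` -/
  r₀ : ℝ
  η₁ : ℝ
  η₂ : ℝ
  γ₁ : ℝ
  γ₂ : ℝ
  γ₃ : ℝ
  κfcd : ℝ
  κrad : ℝ
  /-- smoothing parameters `ε_k` -/
  ε : ℕ → ℝ
  /-- iterates `u_k` -/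
  u : ℕ → U
  /-- trial points, i.e. `u_{k+1}` before the acceptance test -/
  trial : ℕ → U
  /-- trust-region radii `Δ_k` -/
  Δ : ℕ → ℝ
  /-- local models `f_k` of `f` -/
  model : ℕ → U → ℝ
  /-- `true` if the nonconvex model `m_k^ε` is used in iteration `k`, `false` for `m_k` -/
  nonconvex : ℕ → Bool
  /-- computed reductions -/
  cred : ℕ → ℝ

namespace Data

variable {d : ℕ} {Ω : Set (Dom d)} {U : Type*} [NormedAddCommGroup U] [InnerProductSpace ℝ U]
  (D : Data U) (e : U ≃L[ℝ] H01 Ω) (p α β : ℝ) (f : U → ℝ)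

/-- The regularizer in the chosen model: `φ_{ε_k}` or `φ_k`. -/
def reg (k : ℕ) (v : U) : ℝ :=
  if D.nonconvex k = true then phiEps e p α β (D.ε k) v else phiMaj e p α β (D.ε k) (D.u k) v

/-- The chosen model: `m_k^ε = f_k + φ_{ε_k}` or `m_k = f_k + φ_k`. -/
def mod (k : ℕ) (v : U) : ℝ := D.model k v + D.reg e p α β k v

/-- Predicted reduction. -/
def pred (k : ℕ) : ℝ := D.mod e p α β k (D.u k) - D.mod e p α β k (D.trial k)

/-- Actual reduction. -/
def ared (k : ℕ) : ℝ :=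
  f (D.u k) + D.reg e p α β k (D.u k) - f (D.trial k) - D.reg e p α β k (D.trial k)

/-- The ratio `ρ_k` of computed and predicted reduction. -/
def rho (k : ℕ) : ℝ := D.cred k / D.pred e p α β k

/-- The set of successful iterations. -/
def successful : Set ℕ := {k | D.η₁ ≤ D.rho e p α β k}

/-- Inexact objective condition:
`|ared_k - cred_k| ≤ κ_obj (η min(pred_k, θ_k))^ζ` with `θ_k → 0`. -/
def InexactObjective : Prop :=
  ∃ (κobj η ζ : ℝ) (θ : ℕ → ℝ), 0 ≤ κobj ∧ 1 < ζ ∧ 0 < η ∧ η < min D.η₁ (1 - D.η₂) ∧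
    (∀ k, 0 ≤ θ k) ∧ Tendsto θ atTop (𝓝 0) ∧
    ∀ k, |D.ared e p α β f k - D.cred k| ≤ κobj * (η * min (D.pred e p α β k) (θ k)) ^ ζ

variable [CompleteSpace U]

/-- `h_k = (1/r₀) ‖prox_{r₀ φ_k}(u_k - r₀ ∇f_k(u_k)) - u_k‖`. -/
def h (k : ℕ) : ℝ :=
  proxResidual D.r₀ (phiMaj e p α β (D.ε k) (D.u k)) (∇ (D.model k) (D.u k)) (D.u k)

/-- `ω_k = sup {|ω(f_k, u_k, s)| : 0 < ‖s‖ ≤ κ_rad Δ_k}`. -/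
def omega (k : ℕ) : ℝ :=
  sSup {c | ∃ s : U, 0 < ‖s‖ ∧ ‖s‖ ≤ D.κrad * D.Δ k ∧ c = |curvature (D.model k) (D.u k) s|}

/-- `b_k = 1 + max {ω_i : i = 1, …, k}` for `k ≥ 1`. -/
def b (k : ℕ) : ℝ := 1 + sSup (D.omega '' Set.Icc 1 k)

/-- `D` is an (infinite) run of the algorithm. -/
structure IsRun : Prop where
  r₀_pos : 0 < D.r₀
  η₁_pos : 0 < D.η₁
  η₁_lt_η₂ : D.η₁ < D.η₂
  η₂_lt_one : D.η₂ < 1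
  γ₁_pos : 0 < D.γ₁
  γ₁_le_γ₂ : D.γ₁ ≤ D.γ₂
  γ₂_lt_one : D.γ₂ < 1
  one_le_γ₃ : 1 ≤ D.γ₃
  κfcd_pos : 0 < D.κfcd
  κrad_pos : 0 < D.κrad
  ε_pos : ∀ k, 0 < D.ε k
  ε_antitone : Antitone D.ε
  ε_tendsto : Tendsto D.ε atTop (𝓝 0)
  Δ_zero_pos : 0 < D.Δ 0
  /-- fraction of Cauchy decrease condition -/
  fcd : ∀ k, D.κfcd * D.h e p α β k * min (D.h e p α β k / (1 + D.omega k)) (D.Δ k) ≤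
    D.pred e p α β k
  trial_mem : ∀ k, ‖D.trial k - D.u k‖ ≤ D.κrad * D.Δ k
  reject : ∀ k, D.rho e p α β k < D.η₁ → D.u (k + 1) = D.u k
  accept : ∀ k, D.η₁ ≤ D.rho e p α β k → D.u (k + 1) = D.trial k
  radius_unsuccessful : ∀ k, D.rho e p α β k < D.η₁ →
    D.Δ (k + 1) ∈ Set.Icc (D.γ₁ * D.Δ k) (D.γ₂ * D.Δ k)
  radius_successful : ∀ k, D.η₁ ≤ D.rho e p α β k → D.rho e p α β k < D.η₂ →
    D.Δ (k + 1) ∈ Set.Icc (D.γ₂ * D.Δ k) (D.Δ k)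
  radius_very_successful : ∀ k, D.η₂ ≤ D.rho e p α β k →
    D.Δ (k + 1) ∈ Set.Icc (D.Δ k) (D.γ₃ * D.Δ k)

/-- Inexact gradient condition: every `f_k` is `L_k`-smooth for some `L_k`, and
`‖∇f_k(u_k) - ∇f(u_k)‖ ≤ κ_grad min(h_k, Δ_k)` with `κ_grad` independent of `k`. -/
def InexactGradient : Prop :=
  (∀ k, ∃ L : ℝ≥0, IsLSmooth L (D.model k)) ∧
  ∃ κgrad : ℝ, 0 ≤ κgrad ∧ ∀ k,
    ‖∇ (D.model k) (D.u k) - ∇ f (D.u k)‖ ≤ κgrad * min (D.h e p α β k) (D.Δ k)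

/-- Curvature condition `∑_{k ≥ 1} 1 / b_k = ∞`. -/
def CurvatureCondition : Prop :=
  Tendsto (fun n => ∑ k ∈ Finset.Icc 1 n, 1 / D.b k) atTop atTop

end Data

end SmoothedTR

end

/-!
The proximal point `P_k` solves `(P_k - u_k, v) / r + (g_k, v) + α (P_k, v) +
2 β ∫ ψ_ε'(u_k²) P_k v = 0` for all `v`. Taking `v = P_k - u_k → 0` shows that the weighted integral
`∫ ψ_ε'(u_k²) P_k (P_k - u_k)` vanishes in the limit. As `ψ_ε'(t) t ≤ (p/2) t^(p/2)`, this bounds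
the limit superior of `2 ∫ ψ_ε'(u_k²) P_k²` by `p ∫ |ū|^p`; the limit inferior is bounded below by
dominated convergence for the integrands truncated at `(p/2) |ū|^p`. Both bounds use the compact
embedding of `H_0^1` into `L²`: a bounded sequence with vanishing averages over fixed sets vanishes
in `L²`, since small translations of `φ` move it by at most `‖h‖ ‖∇φ‖`.

Taking `v = P_k` then identifies the limit of `α ‖P_k‖²`, and weak lower semicontinuity of the norm
gives the inequality for the multiplier, with equality if `u_k` converges strongly. If only finitely
many iterations succeed, the radii decay geometrically while `∑ 1 / b_k = ∞`, so that `b_k Δ_k`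
is small infinitely often; at such an iteration a residual `h_k` bounded away from zero would force
success, hence `h_k → 0` along a subsequence.
-/

noncomputable section

namespace SmoothedTR

section Smoothing

variable {p ε : ℝ}

lemma sq_rpow_half (p a : ℝ) : (a ^ 2) ^ (p / 2) = |a| ^ p := by
  rw [← sq_abs, ← Real.rpow_natCast, ← Real.rpow_mul (abs_nonneg a), Nat.cast_ofNat,
    mul_div_cancel₀ p two_ne_zero]

lemma sq_rpow_half_sub_one_mul_sq (p : ℝ) {a : ℝ} (ha : a ≠ 0) :
    (a ^ 2) ^ (p / 2 - 1) * a ^ 2 = |a| ^ p := by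
  rw [← Real.rpow_add_one (pow_ne_zero 2 ha), sub_add_cancel, sq_rpow_half]

lemma psi_of_le_sq (hε : 0 < ε) {t : ℝ} (ht : t ≤ ε ^ 2) :
    psi p ε t = p / 2 * (t / ε ^ (2 - p)) + (1 - p / 2) * ε ^ p := by
  rcases ht.lt_or_eq with ht | rfl
  · rw [psi, if_pos ht]
  · have hsq : ε ^ 2 = ε ^ p * ε ^ (2 - p) := by
      rw [← Real.rpow_add hε, add_sub_cancel, Real.rpow_ofNat]
    rw [psi, if_neg (lt_irrefl _), sq_rpow_half, abs_of_pos hε, hsq,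
      mul_div_cancel_right₀ _ (Real.rpow_pos_of_pos hε _).ne']
    ring

lemma psi_of_sq_le {t : ℝ} (ht : ε ^ 2 ≤ t) : psi p ε t = t ^ (p / 2) := if_neg ht.not_gt

lemma hasDerivWithinAt_psi_Iic (hε : 0 < ε) {t : ℝ} (ht : t ≤ ε ^ 2) :
    HasDerivWithinAt (psi p ε) (p / 2 * (ε ^ 2) ^ (p / 2 - 1)) (Set.Iic (ε ^ 2)) t := by
  have hslope : (ε ^ 2) ^ (p / 2 - 1) = 1 / ε ^ (2 - p) := by
    rw [show p / 2 - 1 = (p - 2) / 2 by ring, sq_rpow_half, abs_of_pos hε, one_div,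
      ← Real.rpow_neg hε.le, neg_sub]
  rw [hslope]
  exact ((((hasDerivAt_id t).div_const _).const_mul _).add_const _).hasDerivWithinAt.congr
    (fun s hs => psi_of_le_sq hε hs) (psi_of_le_sq hε ht)

lemma hasDerivWithinAt_psi_Ici (hε : 0 < ε) {t : ℝ} (ht : ε ^ 2 ≤ t) :
    HasDerivWithinAt (psi p ε) (p / 2 * t ^ (p / 2 - 1)) (Set.Ici (ε ^ 2)) t :=
  (Real.hasDerivAt_rpow_const (Or.inl ((pow_pos hε 2).trans_le ht).ne')).hasDerivWithinAt.congr
    (fun _ hs => psi_of_sq_le hs) (psi_of_sq_le ht)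

lemma hasDerivAt_psi (hε : 0 < ε) (t : ℝ) :
    HasDerivAt (psi p ε) (p / 2 * max t (ε ^ 2) ^ (p / 2 - 1)) t := by
  rcases lt_trichotomy t (ε ^ 2) with ht | rfl | ht
  · rw [max_eq_right ht.le]
    exact (hasDerivWithinAt_psi_Iic hε ht.le).hasDerivAt (Iic_mem_nhds ht)
  · rw [max_self, ← hasDerivWithinAt_univ, ← Set.Iic_union_Ici (a := ε ^ 2)]
    exact (hasDerivWithinAt_psi_Iic hε le_rfl).union (hasDerivWithinAt_psi_Ici hε le_rfl)
  · rw [max_eq_left ht.le]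
    exact (hasDerivWithinAt_psi_Ici hε ht.le).hasDerivAt (Ici_mem_nhds ht)

lemma deriv_psi (hε : 0 < ε) (t : ℝ) :
    deriv (psi p ε) t = p / 2 * max t (ε ^ 2) ^ (p / 2 - 1) :=
  (hasDerivAt_psi hε t).deriv

lemma differentiable_psi (hε : 0 < ε) : Differentiable ℝ (psi p ε) :=
  fun t => (hasDerivAt_psi hε t).differentiableAt

lemma deriv_psi_nonneg (hp : 0 ≤ p) (hε : 0 < ε) (t : ℝ) : 0 ≤ deriv (psi p ε) t := by
  rw [deriv_psi hε]
  positivity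

lemma deriv_psi_le (hp : 0 ≤ p) (hp2 : p ≤ 2) (hε : 0 < ε) (t : ℝ) :
    deriv (psi p ε) t ≤ p / 2 * (ε ^ 2) ^ (p / 2 - 1) := by
  rw [deriv_psi hε]
  gcongr ?_ * ?_
  exact Real.rpow_le_rpow_of_nonpos (by positivity) (le_max_right _ _) (by linarith)

lemma norm_deriv_psi_le (hp : 0 ≤ p) (hp2 : p ≤ 2) (hε : 0 < ε) (t : ℝ) :
    ‖deriv (psi p ε) t‖ ≤ p / 2 * (ε ^ 2) ^ (p / 2 - 1) := by
  rw [Real.norm_of_nonneg (deriv_psi_nonneg hp hε t)]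
  exact deriv_psi_le hp hp2 hε t

lemma abs_psi_sub_psi_zero_le (hp : 0 ≤ p) (hp2 : p ≤ 2) (hε : 0 < ε) (t : ℝ) :
    |psi p ε t - psi p ε 0| ≤ p / 2 * (ε ^ 2) ^ (p / 2 - 1) * |t| := by
  simpa using convex_univ.norm_image_sub_le_of_norm_deriv_le
    (fun s _ => differentiable_psi hε s) (fun s _ => norm_deriv_psi_le hp hp2 hε s)
    (Set.mem_univ 0) (Set.mem_univ t)

lemma deriv_psi_sq_mul_sq_le (hp : 0 < p) (hp2 : p ≤ 2) (hε : 0 < ε) (a : ℝ) :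
    deriv (psi p ε) (a ^ 2) * a ^ 2 ≤ p / 2 * |a| ^ p := by
  rcases eq_or_ne a 0 with rfl | ha
  · simp [hp.ne']
  · rw [deriv_psi hε, mul_assoc, ← sq_rpow_half_sub_one_mul_sq p ha]
    gcongr ?_ * (?_ * ?_)
    exact Real.rpow_le_rpow_of_nonpos (by positivity) (le_max_left _ _) (by linarith)

/- At `c = 0` the factors need not converge, but the truncation makes the sequence vanish. -/
lemma tendsto_min_deriv_psi_sq_mul_sq (hp : 0 < p) {ε a b : ℕ → ℝ} {c : ℝ}
    (hε : ∀ k, 0 < ε k) (hε0 : Tendsto ε atTop (𝓝 0)) (ha : Tendsto a atTop (𝓝 c))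
    (hb : Tendsto b atTop (𝓝 c)) :
    Tendsto (fun k => min (deriv (psi p (ε k)) (b k ^ 2) * a k ^ 2) (p / 2 * |c| ^ p)) atTop
      (𝓝 (p / 2 * |c| ^ p)) := by
  rcases eq_or_ne c 0 with rfl | hc
  · refine tendsto_const_nhds.congr fun k => (min_eq_right ?_).symm
    rw [abs_zero, Real.zero_rpow hp.ne', mul_zero]
    exact mul_nonneg (deriv_psi_nonneg hp.le (hε k) _) (sq_nonneg _)
  · have hmax : Tendsto (fun k => max (b k ^ 2) (ε k ^ 2)) atTop (𝓝 (c ^ 2)) := by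
      simpa [sq_nonneg] using (hb.pow 2).max (hε0.pow 2)
    have hprod : Tendsto (fun k => deriv (psi p (ε k)) (b k ^ 2) * a k ^ 2) atTop
        (𝓝 (p / 2 * |c| ^ p)) := by
      rw [← sq_rpow_half_sub_one_mul_sq p hc, ← mul_assoc]
      simp_rw [fun k => deriv_psi (p := p) (hε k)]
      exact ((hmax.rpow_const (Or.inl (pow_ne_zero 2 hc))).const_mul _).mul (ha.pow 2)
    simpa using hprod.min (tendsto_const_nhds (x := p / 2 * |c| ^ p))

end Smoothing

section SquareIntegrable

variable {X : Type*} [MeasurableSpace X] {μ : Measure X} {p : ℝ}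

lemma abs_rpow_sub_rpow_le {q x y : ℝ} (hq : 0 ≤ q) (hq1 : q ≤ 1) (hx : 0 ≤ x) (hy : 0 ≤ y) :
    |x ^ q - y ^ q| ≤ |x - y| ^ q := by
  wlog hyx : y ≤ x generalizing x y
  · rw [abs_sub_comm, abs_sub_comm x]
    exact this hy hx (le_of_not_ge hyx)
  have hadd := Real.rpow_add_le_add_rpow (sub_nonneg.2 hyx) hy hq hq1
  rw [sub_add_cancel] at hadd
  rw [abs_of_nonneg (sub_nonneg.2 hyx),
    abs_of_nonneg (sub_nonneg.2 (Real.rpow_le_rpow hy hyx hq))]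
  linarith

lemma rpow_le_rpow_add_rpow_sub_one_mul {q l t : ℝ} (hq : 0 ≤ q) (hq1 : q ≤ 1) (hl : 0 < l)
    (ht : 0 ≤ t) : t ^ q ≤ l ^ q + l ^ (q - 1) * t := by
  rcases le_total t l with h | h
  · exact (Real.rpow_le_rpow ht h hq).trans (le_add_of_nonneg_right (by positivity))
  · calc t ^ q = t ^ (q - 1) * t := by
          rw [← Real.rpow_add_one (hl.trans_le h).ne', sub_add_cancel]
      _ ≤ l ^ (q - 1) * t := by
          gcongr ?_ * t
          exact Real.rpow_le_rpow_of_nonpos hl h (by linarith)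
      _ ≤ l ^ q + l ^ (q - 1) * t := le_add_of_nonneg_left (by positivity)

lemma tendsto_integral_abs_sq_sub_sq (a : Lp ℝ 2 μ) :
    Tendsto (fun u : Lp ℝ 2 μ => ∫ x, |u x ^ 2 - a x ^ 2| ∂μ) (𝓝 a) (𝓝 0) := by
  let sq : Lp ℝ 2 μ → Lp ℝ 1 μ := fun u => (ContinuousLinearMap.mul ℝ ℝ).holderL μ 2 2 1 u u
  have hsq : ∀ u, sq u =ᵐ[μ] fun x => u x ^ 2 := fun u => by
    filter_upwards [(ContinuousLinearMap.mul ℝ ℝ).coeFn_holder (r := 1) u u] with x hx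
    exact hx.trans (pow_two _).symm
  have hcont : Continuous sq := by fun_prop
  refine (tendsto_iff_norm_sub_tendsto_zero.1 (hcont.tendsto a)).congr fun u => ?_
  rw [L1.norm_eq_integral_norm]
  refine integral_congr_ae ?_
  filter_upwards [Lp.coeFn_sub (sq u) (sq a), hsq u, hsq a] with x hx hu ha
  rw [hx, Pi.sub_apply, hu, ha, Real.norm_eq_abs]

lemma integrable_abs_rpow [IsFiniteMeasure μ] (hp : 0 ≤ p) (hp2 : p ≤ 2) (u : Lp ℝ 2 μ) :
    Integrable (fun x => |u x| ^ p) μ := by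
  have hu : MemLp u (ENNReal.ofReal p) μ :=
    (Lp.memLp u).mono_exponent (ENNReal.ofReal_le_ofNat.2 hp2)
  simpa [hp] using hu.integrable_norm_rpow'

lemma abs_integral_abs_rpow_sub_le [IsFiniteMeasure μ] (hp : 0 ≤ p) (hp2 : p ≤ 2) {l : ℝ}
    (hl : 0 < l) (u v : Lp ℝ 2 μ) :
    |(∫ x, |u x| ^ p ∂μ) - ∫ x, |v x| ^ p ∂μ| ≤
      μ.real Set.univ * l ^ (p / 2) + l ^ (p / 2 - 1) * ∫ x, |u x ^ 2 - v x ^ 2| ∂μ := by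
  have hu := integrable_abs_rpow hp hp2 u
  have hv := integrable_abs_rpow hp hp2 v
  have hsq : Integrable (fun x => l ^ (p / 2 - 1) * |u x ^ 2 - v x ^ 2|) μ :=
    ((Lp.memLp u).integrable_sq.sub (Lp.memLp v).integrable_sq).abs.const_mul _
  calc |(∫ x, |u x| ^ p ∂μ) - ∫ x, |v x| ^ p ∂μ|
      ≤ ∫ x, |(|u x| ^ p - |v x| ^ p)| ∂μ := by
        rw [← integral_sub hu hv]
        exact abs_integral_le_integral_abs
    _ ≤ ∫ x, (l ^ (p / 2) + l ^ (p / 2 - 1) * |u x ^ 2 - v x ^ 2|) ∂μ := by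
        refine integral_mono (hu.sub hv).abs ((integrable_const _).add hsq) fun x => ?_
        simp only [← sq_rpow_half]
        exact (abs_rpow_sub_rpow_le (by linarith) (by linarith) (sq_nonneg _) (sq_nonneg _)).trans
          (rpow_le_rpow_add_rpow_sub_one_mul (by linarith) (by linarith) hl (abs_nonneg _))
    _ = μ.real Set.univ * l ^ (p / 2) + l ^ (p / 2 - 1) * ∫ x, |u x ^ 2 - v x ^ 2| ∂μ := by
        rw [integral_add (integrable_const _) hsq, integral_const_mul, integral_const, smul_eq_mul]

lemma continuous_integral_abs_rpow [IsFiniteMeasure μ] (hp : 0 < p) (hp2 : p ≤ 2) :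
    Continuous fun u : Lp ℝ 2 μ => ∫ x, |u x| ^ p ∂μ := by
  refine continuous_iff_continuousAt.2 fun a => Metric.tendsto_nhds.2 fun δ hδ => ?_
  obtain ⟨l, hlδ, hl⟩ : ∃ l : ℝ, μ.real Set.univ * l ^ (p / 2) < δ ∧ 0 < l := by
    have hcont : ContinuousAt (fun l : ℝ => μ.real Set.univ * l ^ (p / 2)) 0 :=
      (Real.continuousAt_rpow_const 0 _ (Or.inr (by positivity))).const_mul _
    have hlim := hcont.tendsto.mono_left (nhdsWithin_le_nhds (s := Set.Ioi 0))
    rw [Real.zero_rpow (by positivity), mul_zero] at hlim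
    exact ((hlim.eventually_lt_const hδ).and self_mem_nhdsWithin).exists
  have hbound : Tendsto (fun u : Lp ℝ 2 μ => μ.real Set.univ * l ^ (p / 2) +
      l ^ (p / 2 - 1) * ∫ x, |u x ^ 2 - a x ^ 2| ∂μ) (𝓝 a) (𝓝 (μ.real Set.univ * l ^ (p / 2))) := by
    simpa using ((tendsto_integral_abs_sq_sub_sq a).const_mul _).const_add _
  filter_upwards [hbound.eventually_lt_const hlδ] with u hu
  exact (abs_integral_abs_rpow_sub_le hp.le hp2 hl u a).trans_lt hu

/-- The bilinear form `∫ m a b` on `L²`, for a bounded weight `m`. -/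
def weightedForm {m : X → ℝ} (hm : MemLp m ⊤ μ) : Lp ℝ 2 μ →L[ℝ] Lp ℝ 2 μ →L[ℝ] ℝ :=
  (innerSL ℝ).comp ((ContinuousLinearMap.mul ℝ ℝ).holderL μ ⊤ 2 2 hm.toLp)

lemma weightedForm_apply {m : X → ℝ} (hm : MemLp m ⊤ μ) (a b : Lp ℝ 2 μ) :
    weightedForm hm a b = ∫ x, m x * (a x * b x) ∂μ := by
  change ⟪(ContinuousLinearMap.mul ℝ ℝ).holder 2 hm.toLp a, b⟫ = _
  rw [L2.inner_def]
  refine integral_congr_ae ?_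
  filter_upwards [(ContinuousLinearMap.mul ℝ ℝ).coeFn_holder (r := 2) hm.toLp a,
    hm.coeFn_toLp] with x hx hmx
  rw [hx, hmx, ContinuousLinearMap.mul_apply', real_inner_eq_re_inner, RCLike.inner_apply]
  simp only [conj_trivial, RCLike.re_to_real]
  ring

section SmoothedWeight

variable {ε : ℝ} (hp : 0 < p) (hp2 : p ≤ 2) (hε : 0 < ε) (w a b : Lp ℝ 2 μ)

include hp hp2 hε in
lemma memLp_top_deriv_psi_sq : MemLp (fun x => deriv (psi p ε) (w x ^ 2)) ⊤ μ :=
  memLp_top_of_bound ((measurable_deriv _).comp_aemeasurable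
    ((Lp.aestronglyMeasurable w).aemeasurable.pow_const 2)).aestronglyMeasurable _
    (Eventually.of_forall fun _ => norm_deriv_psi_le hp.le hp2 hε _)

include hp hp2 hε in
lemma integrable_deriv_psi_sq_mul {g : X → ℝ} (hg : Integrable g μ) :
    Integrable (fun x => deriv (psi p ε) (w x ^ 2) * g x) μ :=
  hg.bdd_mul (memLp_top_deriv_psi_sq hp hp2 hε w).1
    (Eventually.of_forall fun _ => norm_deriv_psi_le hp.le hp2 hε _)

/-- The bilinear form `∫ ψ_ε'(w²) a b` on `L²`; its quadratic form is the part of the majorant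
`jMaj` of `j_ε` at `w` that is not constant. -/
def psiForm : Lp ℝ 2 μ →L[ℝ] Lp ℝ 2 μ →L[ℝ] ℝ :=
  weightedForm (memLp_top_deriv_psi_sq hp hp2 hε w)

lemma psiForm_apply :
    psiForm hp hp2 hε w a b = ∫ x, deriv (psi p ε) (w x ^ 2) * (a x * b x) ∂μ :=
  weightedForm_apply _ a b

lemma psiForm_self : psiForm hp hp2 hε w a a = ∫ x, deriv (psi p ε) (w x ^ 2) * a x ^ 2 ∂μ := by
  simp only [psiForm_apply, pow_two]

lemma psiForm_comm : psiForm hp hp2 hε w a b = psiForm hp hp2 hε w b a := by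
  simp only [psiForm_apply, mul_comm (a _)]

lemma psiForm_self_nonneg : 0 ≤ psiForm hp hp2 hε w a a := by
  rw [psiForm_self]
  exact integral_nonneg fun x => mul_nonneg (deriv_psi_nonneg hp.le hε _) (sq_nonneg _)

lemma psiForm_diag_le [IsFiniteMeasure μ] :
    psiForm hp hp2 hε w w w ≤ p / 2 * ∫ x, |w x| ^ p ∂μ := by
  rw [psiForm_self, ← integral_const_mul]
  exact integral_mono (integrable_deriv_psi_sq_mul hp hp2 hε w (Lp.memLp w).integrable_sq)
    ((integrable_abs_rpow hp.le hp2 w).const_mul _) fun x => deriv_psi_sq_mul_sq_le hp hp2 hε (w x)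

/- Expand `w = a - (a - w)` in `psiForm_diag_le` and drop the square of `a - w`. -/
lemma psiForm_self_le [IsFiniteMeasure μ] :
    psiForm hp hp2 hε w a a ≤
      p / 2 * (∫ x, |w x| ^ p ∂μ) + 2 * psiForm hp hp2 hε w a (a - w) := by
  have hdiff := psiForm_self_nonneg hp hp2 hε w (a - w)
  simp only [map_sub, sub_apply, psiForm_comm hp hp2 hε w w a] at hdiff ⊢
  linarith [psiForm_diag_le hp hp2 hε w]

lemma integrable_psi_sq [IsFiniteMeasure μ] (hp : 0 < p) (hp2 : p ≤ 2) (hε : 0 < ε) :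
    Integrable (fun x => psi p ε (w x ^ 2)) μ := by
  have hsub : Integrable (fun x => psi p ε (w x ^ 2) - psi p ε 0) μ := by
    refine ((Lp.memLp w).integrable_sq.abs.const_mul
      (p / 2 * (ε ^ 2) ^ (p / 2 - 1))).mono' ?_
        (Eventually.of_forall fun x => abs_psi_sub_psi_zero_le hp.le hp2 hε _)
    exact ((differentiable_psi hε).continuous.comp_aestronglyMeasurable
      ((Lp.aestronglyMeasurable w).pow 2)).sub aestronglyMeasurable_const
  exact (hsub.add (integrable_const (psi p ε 0))).congr
    (Eventually.of_forall fun _ => sub_add_cancel _ _)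

lemma integral_psi_majorant [IsFiniteMeasure μ] :
    ∫ x, (psi p ε (w x ^ 2) + deriv (psi p ε) (w x ^ 2) * (a x ^ 2 - w x ^ 2)) ∂μ =
      (∫ x, psi p ε (w x ^ 2) ∂μ) - psiForm hp hp2 hε w w w + psiForm hp hp2 hε w a a := by
  have hψ := integrable_psi_sq w hp hp2 hε
  have hw := integrable_deriv_psi_sq_mul hp hp2 hε w (Lp.memLp w).integrable_sq
  have ha := integrable_deriv_psi_sq_mul hp hp2 hε w (Lp.memLp a).integrable_sq
  have hconst : Integrable (fun x => psi p ε (w x ^ 2) -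
      deriv (psi p ε) (w x ^ 2) * w x ^ 2) μ := hψ.sub hw
  rw [psiForm_self, psiForm_self, ← integral_sub hψ hw, ← integral_add hconst ha]
  congr with x
  ring

end SmoothedWeight

section SmoothedLimit

variable [IsFiniteMeasure μ] {ε : ℕ → ℝ} {u a : ℕ → Lp ℝ 2 μ} {c : Lp ℝ 2 μ}

lemma tendsto_integral_min_deriv_psi (hp : 0 < p) (hp2 : p ≤ 2) (hε : ∀ k, 0 < ε k)
    (hε0 : Tendsto ε atTop (𝓝 0))
    (hu : ∀ᵐ x ∂μ, Tendsto (fun k => u k x) atTop (𝓝 (c x)))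
    (ha : ∀ᵐ x ∂μ, Tendsto (fun k => a k x) atTop (𝓝 (c x))) :
    Tendsto (fun k => ∫ x, min (deriv (psi p (ε k)) (u k x ^ 2) * a k x ^ 2)
      (p / 2 * |c x| ^ p) ∂μ) atTop (𝓝 (p / 2 * ∫ x, |c x| ^ p ∂μ)) := by
  have hc := (integrable_abs_rpow hp.le hp2 c).const_mul (p / 2)
  rw [← integral_const_mul]
  refine tendsto_integral_of_dominated_convergence _ (fun k => ?_) hc
    (fun k => Eventually.of_forall fun x => ?_) ?_
  · exact (integrable_deriv_psi_sq_mul hp hp2 (hε k) _ (Lp.memLp (a k)).integrable_sq).1.inf hc.1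
  · have hnonneg : 0 ≤ deriv (psi p (ε k)) (u k x ^ 2) * a k x ^ 2 :=
      mul_nonneg (deriv_psi_nonneg hp.le (hε k) _) (sq_nonneg _)
    rw [Real.norm_of_nonneg (le_min hnonneg (by positivity))]
    exact min_le_right _ _
  · filter_upwards [hu, ha] with x hux hax
    exact tendsto_min_deriv_psi_sq_mul_sq hp hε hε0 hax hux

theorem tendsto_psiForm_self (hp : 0 < p) (hp2 : p ≤ 2) (hε : ∀ k, 0 < ε k)
    (hε0 : Tendsto ε atTop (𝓝 0)) (hu : Tendsto u atTop (𝓝 c)) (ha : Tendsto a atTop (𝓝 c))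
    (hform : Tendsto (fun k => psiForm hp hp2 (hε k) (u k) (a k) (a k - u k)) atTop (𝓝 0)) :
    Tendsto (fun k => psiForm hp hp2 (hε k) (u k) (a k) (a k)) atTop
      (𝓝 (p / 2 * ∫ x, |c x| ^ p ∂μ)) := by
  have hupper : Tendsto (fun k => p / 2 * (∫ x, |u k x| ^ p ∂μ) +
      2 * psiForm hp hp2 (hε k) (u k) (a k) (a k - u k)) atTop
      (𝓝 (p / 2 * ∫ x, |c x| ^ p ∂μ)) := by
    simpa using ((((continuous_integral_abs_rpow hp hp2).tendsto c).comp hu).const_mul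
      (p / 2)).add (hform.const_mul 2)
  refine tendsto_of_subseq_tendsto fun ns hns => ?_
  obtain ⟨ms, hms, hu_ae⟩ := (tendstoInMeasure_of_tendsto_Lp (hu.comp hns)).exists_seq_tendsto_ae
  obtain ⟨ls, hls, ha_ae⟩ := (tendstoInMeasure_of_tendsto_Lp
    (ha.comp (hns.comp hms.tendsto_atTop))).exists_seq_tendsto_ae
  have hsub := hns.comp (hms.tendsto_atTop.comp hls.tendsto_atTop)
  have hlower := tendsto_integral_min_deriv_psi hp hp2 (fun k => hε (ns (ms (ls k))))
    (hε0.comp hsub) (hu_ae.mono fun x hx => hx.comp hls.tendsto_atTop) ha_ae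
  refine ⟨fun k => ms (ls k), tendsto_of_tendsto_of_tendsto_of_le_of_le hlower (hupper.comp hsub)
    (fun k => ?_) fun k => psiForm_self_le hp hp2 (hε _) _ _⟩
  have hint := integrable_deriv_psi_sq_mul hp hp2 (hε (ns (ms (ls k)))) (u (ns (ms (ls k))))
    (Lp.memLp (a (ns (ms (ls k))))).integrable_sq
  simp only [psiForm_self]
  exact integral_mono (hint.inf ((integrable_abs_rpow hp.le hp2 c).const_mul (p / 2))) hint
    fun x => min_le_left _ _

end SmoothedLimit

end SquareIntegrable

section Averages

open scoped ENNReal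

variable {X Y F : Type*} [MeasurableSpace X] [MeasurableSpace Y] [NormedAddCommGroup F]
  {q : ℝ≥0∞}

lemma enorm_eq_eLpNorm_of_ae_eq {μ : Measure X} {s : Set X} {w : Lp F q (μ.restrict s)} {g : X → F}
    (hg : w =ᵐ[μ.restrict s] g) (hsupp : Function.support g ⊆ s) : ‖w‖ₑ = eLpNorm g q μ := by
  rw [Lp.enorm_def, eLpNorm_congr_ae hg, eLpNorm_restrict_eq_of_support_subset hsupp]

lemma tendsto_eLpNorm_zero_of_enorm_le {μ : Measure X} [IsFiniteMeasure μ] (hq : 1 ≤ q)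
    (hq' : q ≠ ⊤) {f : ℕ → X → F} (hf : ∀ k, AEStronglyMeasurable (f k) μ) {C : ℝ≥0∞}
    (hC : C ≠ ⊤) (hbound : ∀ k x, ‖f k x‖ₑ ≤ C)
    (hlim : ∀ᵐ x ∂μ, Tendsto (fun k => f k x) atTop (𝓝 0)) :
    Tendsto (fun k => eLpNorm (f k) q μ) atTop (𝓝 0) := by
  have hq0 : 0 < q.toReal := ENNReal.toReal_pos (zero_lt_one.trans_le hq).ne' hq'
  have hpow : Tendsto (fun k => ∫⁻ x, ‖f k x‖ₑ ^ q.toReal ∂μ) atTop (𝓝 0) := by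
    have := tendsto_lintegral_of_dominated_convergence' (μ := μ) (f := fun _ => 0)
      (fun _ => C ^ q.toReal) (fun k => (hf k).enorm.pow_const q.toReal)
      (fun k => Eventually.of_forall fun x => ENNReal.rpow_le_rpow (hbound k x) hq0.le)
      (by simp [ENNReal.mul_eq_top, hC, hq0.le]) ?_
    · simpa using this
    · filter_upwards [hlim] with x hx
      simpa [ENNReal.zero_rpow_of_pos hq0] using hx.enorm.ennrpow_const q.toReal
  simpa [eLpNorm_eq_lintegral_rpow_enorm_toReal (zero_lt_one.trans_le hq).ne' hq',
    ENNReal.zero_rpow_of_pos (inv_pos.2 hq0)] using hpow.ennrpow_const (1 / q.toReal)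

variable [NormedSpace ℝ F]

lemma enorm_integral_le_eLpNorm {ν : Measure Y} [IsProbabilityMeasure ν] (hq : 1 ≤ q) {f : Y → F}
    (hf : AEStronglyMeasurable f ν) : ‖∫ y, f y ∂ν‖ₑ ≤ eLpNorm f q ν :=
  (enorm_integral_le_lintegral_enorm f).trans <|
    eLpNorm_one_eq_lintegral_enorm (f := f).symm.trans_le <|
      eLpNorm_le_eLpNorm_of_exponent_le hq hf

lemma eLpNorm_integral_le {μ : Measure X} [SFinite μ] {ν : Measure Y} [IsProbabilityMeasure ν]
    (hq : 1 ≤ q) (hq' : q ≠ ⊤) {f : X → Y → F} (hf : StronglyMeasurable f.uncurry) {C : ℝ≥0∞}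
    (hC : ∀ᵐ y ∂ν, eLpNorm (fun x => f x y) q μ ≤ C) :
    eLpNorm (fun x => ∫ y, f x y ∂ν) q μ ≤ C := by
  lift q to ℝ≥0 using hq'
  have hq0 : q ≠ 0 := (zero_lt_one.trans_le (ENNReal.one_le_coe_iff.1 hq)).ne'
  refine (ENNReal.rpow_le_rpow_iff (NNReal.coe_pos.2 (pos_iff_ne_zero.2 hq0))).1 ?_
  calc eLpNorm (fun x => ∫ y, f x y ∂ν) q μ ^ (q : ℝ)
      = ∫⁻ x, ‖∫ y, f x y ∂ν‖ₑ ^ (q : ℝ) ∂μ := eLpNorm_nnreal_pow_eq_lintegral hq0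
    _ ≤ ∫⁻ x, eLpNorm (f x) q ν ^ (q : ℝ) ∂μ := by
        gcongr with x
        exact enorm_integral_le_eLpNorm hq
          (hf.comp_measurable measurable_prodMk_left).aestronglyMeasurable
    _ = ∫⁻ x, ∫⁻ y, ‖f x y‖ₑ ^ (q : ℝ) ∂ν ∂μ := by
        simp only [eLpNorm_nnreal_pow_eq_lintegral hq0]
    _ = ∫⁻ y, ∫⁻ x, ‖f x y‖ₑ ^ (q : ℝ) ∂μ ∂ν :=
        lintegral_lintegral_swap (hf.enorm.pow_const _).aemeasurable
    _ = ∫⁻ y, eLpNorm (fun x => f x y) q μ ^ (q : ℝ) ∂ν := by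
        simp only [eLpNorm_nnreal_pow_eq_lintegral hq0]
    _ ≤ ∫⁻ _, C ^ (q : ℝ) ∂ν := lintegral_mono_ae <| hC.mono fun y hy => by gcongr
    _ = C ^ (q : ℝ) := by simp

end Averages

section Translation

open scoped ENNReal

variable {E F : Type*} [NormedAddCommGroup E] [NormedSpace ℝ E] [NormedAddCommGroup F]
  [NormedSpace ℝ F] [CompleteSpace F]

lemma sub_eq_integral_fderiv {φ : E → F} (hφ : ContDiff ℝ 1 φ) (x h : E) :
    φ (x + h) - φ x = ∫ t in Set.Ioc (0 : ℝ) 1, fderiv ℝ φ (x + t • h) h := by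
  have hcont : Continuous fun t : ℝ => fderiv ℝ φ (x + t • h) h := by
    have := hφ.continuous_fderiv one_ne_zero
    fun_prop
  have hderiv (t : ℝ) : HasDerivAt (fun t : ℝ => φ (x + t • h)) (fderiv ℝ φ (x + t • h) h) t := by
    have hline : HasDerivAt (fun t : ℝ => x + t • h) h t := by
      simpa using ((hasDerivAt_id t).smul_const h).const_add x
    exact (hφ.differentiable one_ne_zero (x + t • h)).hasFDerivAt.comp_hasDerivAt t hline
  have hftc := intervalIntegral.integral_eq_sub_of_hasDerivAt (a := 0) (b := 1)
    (fun t _ => hderiv t) (hcont.intervalIntegrable _ _)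
  simpa [intervalIntegral.integral_of_le zero_le_one] using hftc.symm

variable [SecondCountableTopology E] [MeasurableSpace E] [BorelSpace E] {μ : Measure E} [SFinite μ]
  [μ.IsAddRightInvariant] {q : ℝ≥0∞}

lemma eLpNorm_translate_sub_le (hq : 1 ≤ q) (hq' : q ≠ ⊤) {φ : E → F} (hφ : ContDiff ℝ 1 φ)
    (h : E) :
    eLpNorm (fun x => φ (x + h) - φ x) q μ ≤ ‖h‖ₑ * eLpNorm (fderiv ℝ φ) q μ := by
  have hcont := hφ.continuous_fderiv one_ne_zero
  have : IsProbabilityMeasure (volume.restrict (Set.Ioc (0 : ℝ) 1)) := ⟨by simp⟩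
  simp only [sub_eq_integral_fderiv hφ]
  refine eLpNorm_integral_le hq hq' (f := fun x t => fderiv ℝ φ (x + t • h) h)
    (Continuous.stronglyMeasurable (by fun_prop)) (Eventually.of_forall fun t => ?_)
  have htranslate : eLpNorm (fun x => fderiv ℝ φ (x + t • h)) q μ = eLpNorm (fderiv ℝ φ) q μ :=
    eLpNorm_comp_measurePreserving hcont.aestronglyMeasurable
      (measurePreserving_add_right μ (t • h))
  rw [← htranslate]
  refine (eLpNorm_le_nnreal_smul_eLpNorm_of_ae_le_mul (c := ‖h‖₊)
    (Eventually.of_forall fun x => ?_) q).trans_eq (by rfl)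
  rw [mul_comm]
  exact ContinuousLinearMap.le_opNNNorm _ _

lemma eLpNorm_sub_average_le (hq : 1 ≤ q) (hq' : q ≠ ⊤) {φ : E → F} (hφ : ContDiff ℝ 1 φ)
    (hc : HasCompactSupport φ) {ν : Measure E} [IsProbabilityMeasure ν] {δ : ℝ≥0∞}
    (hν : ∀ᵐ h ∂ν, ‖h‖ₑ ≤ δ) :
    eLpNorm (fun x => φ x - ∫ h, φ (x + h) ∂ν) q μ
      ≤ δ * eLpNorm (fderiv ℝ φ) q μ := by
  have hφc := hφ.continuous
  obtain ⟨C, hC⟩ := hc.exists_bound_of_continuous hφc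
  have hint (x : E) : Integrable (fun h => φ (x + h)) ν :=
    Integrable.of_bound (by fun_prop) C (Eventually.of_forall fun h => hC _)
  have haverage (x : E) : φ x - ∫ h, φ (x + h) ∂ν = -∫ h, (φ (x + h) - φ x) ∂ν := by
    simp [integral_sub (hint x) (integrable_const _)]
  simp only [haverage]
  refine (eLpNorm_neg (fun x => ∫ h, (φ (x + h) - φ x) ∂ν) q μ).trans_le ?_
  refine eLpNorm_integral_le hq hq' (f := fun x h => φ (x + h) - φ x)
    (Continuous.stronglyMeasurable (by fun_prop)) ?_
  filter_upwards [hν] with h hh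
  exact (eLpNorm_translate_sub_le hq hq' hφ h).trans (by gcongr)

end Translation

section VanishingAverages

open scoped ENNReal ProbabilityTheory

variable {E F : Type*} [NormedAddCommGroup E] [MeasurableSpace E] [BorelSpace E]
  {μ : Measure E} [NormedAddCommGroup F] {q : ℝ≥0∞}

lemma eLpNorm_translate_cond_le [μ.IsAddLeftInvariant] (hq' : q ≠ ⊤) {φ : E → F}
    (hφ : AEStronglyMeasurable φ μ) (B : Set E) (x : E) :
    eLpNorm (fun h => φ (x + h)) q μ[|B] ≤ (μ B)⁻¹ ^ (1 / q.toReal) * eLpNorm φ q μ := by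
  rw [ProbabilityTheory.cond, eLpNorm_smul_measure_of_ne_top hq', smul_eq_mul,
    ← eLpNorm_comp_measurePreserving hφ (measurePreserving_add_left μ x)]
  rw [ENNReal.toReal_div, ENNReal.toReal_one]
  gcongr (μ B)⁻¹ ^ (1 / q.toReal) * ?_
  exact eLpNorm_mono_measure _ Measure.restrict_le_self

variable [NormedSpace ℝ F]

lemma integral_translate_cond [μ.IsAddLeftInvariant] (φ : E → F) (B : Set E) (x : E) :
    ∫ h, φ (x + h) ∂μ[|B] = (μ B)⁻¹.toReal • ∫ y in (fun y => -x + y) ⁻¹' B, φ y ∂μ := by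
  have hpreimage : (fun y => x + y) ⁻¹' ((fun y => -x + y) ⁻¹' B) = B := by
    ext h
    simp
  have htranslate := (measurePreserving_add_left μ x).setIntegral_preimage_emb
    (measurableEmbedding_addLeft x) φ ((fun y => -x + y) ⁻¹' B)
  rw [ProbabilityTheory.cond, integral_smul_measure, ← htranslate, hpreimage]

lemma tendsto_eLpNorm_average [SecondCountableTopology E] [μ.IsAddLeftInvariant] (hq : 1 ≤ q)
    (hq' : q ≠ ⊤) {Ω B : Set E} (hΩ : μ Ω ≠ ⊤) (hB : MeasurableSet B)
    (hB0 : μ B ≠ 0) (hB_top : μ B ≠ ⊤) {φ : ℕ → E → F} (hφ : ∀ k, Continuous (φ k))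
    {M : ℝ≥0∞} (hM : M ≠ ⊤) (hbound : ∀ k, eLpNorm (φ k) q μ ≤ M)
    (hlim : ∀ S, MeasurableSet S → Tendsto (fun k => ∫ x in S, φ k x ∂μ) atTop (𝓝 0)) :
    Tendsto (fun k => eLpNorm (fun x => ∫ h, φ k (x + h) ∂μ[|B]) q (μ.restrict Ω)) atTop
      (𝓝 0) := by
  have : IsFiniteMeasure (μ.restrict Ω) := ⟨by simpa [lt_top_iff_ne_top] using hΩ⟩
  have := ProbabilityTheory.cond_isProbabilityMeasure_of_finite hB0 hB_top
  refine tendsto_eLpNorm_zero_of_enorm_le hq hq' (fun k => ?_)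
    (C := (μ B)⁻¹ ^ (1 / q.toReal) * M) ?_ (fun k x => ?_) (Eventually.of_forall fun x => ?_)
  · have := hφ k
    exact (Continuous.stronglyMeasurable (f := fun z : E × E => φ k (z.1 + z.2))
      (by fun_prop)).integral_prod_right.aestronglyMeasurable
  · exact ENNReal.mul_ne_top (ENNReal.rpow_ne_top_of_nonneg (by positivity) (by simpa)) hM
  · have := hφ k
    refine (enorm_integral_le_eLpNorm hq (Continuous.aestronglyMeasurable (by fun_prop))).trans ?_
    exact (eLpNorm_translate_cond_le hq' (hφ k).aestronglyMeasurable B x).trans <| by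
      gcongr
      exact hbound k
  · simpa [integral_translate_cond] using
      (hlim _ (measurable_const_add (-x) hB)).const_smul (μ B)⁻¹.toReal

variable [NormedSpace ℝ E] [FiniteDimensional ℝ E] [μ.IsAddHaarMeasure] [CompleteSpace F]

lemma eLpNorm_le_mul_fderiv_add_average (hq : 1 ≤ q) (hq' : q ≠ ⊤) {φ : E → F}
    (hφ : ContDiff ℝ 1 φ) (hc : HasCompactSupport φ) {Ω : Set E} (hsupp : Function.support φ ⊆ Ω)
    {ν : Measure E} [IsProbabilityMeasure ν] {δ : ℝ≥0∞} (hν : ∀ᵐ h ∂ν, ‖h‖ₑ ≤ δ) :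
    eLpNorm φ q μ ≤ δ * eLpNorm (fderiv ℝ φ) q μ
      + eLpNorm (fun x => ∫ h, φ (x + h) ∂ν) q (μ.restrict Ω) := by
  have hcont := hφ.continuous
  have hA : StronglyMeasurable fun x => ∫ h, φ (x + h) ∂ν :=
    (Continuous.stronglyMeasurable (f := fun z : E × E => φ (z.1 + z.2))
      (by fun_prop)).integral_prod_right
  calc eLpNorm φ q μ = eLpNorm φ q (μ.restrict Ω) :=
        (eLpNorm_restrict_eq_of_support_subset hsupp).symm
    _ = eLpNorm ((fun x => φ x - ∫ h, φ (x + h) ∂ν) + fun x => ∫ h, φ (x + h) ∂ν)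
          q (μ.restrict Ω) := by simp [Pi.add_def]
    _ ≤ eLpNorm (fun x => φ x - ∫ h, φ (x + h) ∂ν) q (μ.restrict Ω)
          + eLpNorm (fun x => ∫ h, φ (x + h) ∂ν) q (μ.restrict Ω) :=
        eLpNorm_add_le (hcont.aestronglyMeasurable.sub hA.aestronglyMeasurable)
          hA.aestronglyMeasurable hq
    _ ≤ δ * eLpNorm (fderiv ℝ φ) q μ + eLpNorm (fun x => ∫ h, φ (x + h) ∂ν) q (μ.restrict Ω) := by
        gcongr
        exact (eLpNorm_mono_measure _ Measure.restrict_le_self).trans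
          (eLpNorm_sub_average_le hq hq' hφ hc hν)

theorem tendsto_eLpNorm_of_tendsto_setIntegral (hq : 1 ≤ q) (hq' : q ≠ ⊤) {Ω : Set E}
    (hΩ : μ Ω ≠ ⊤) {φ : ℕ → E → F} (hφ : ∀ k, ContDiff ℝ 1 (φ k))
    (hc : ∀ k, HasCompactSupport (φ k)) (hsupp : ∀ k, Function.support (φ k) ⊆ Ω)
    {M : ℝ≥0∞} (hM : M ≠ ⊤) (hbound : ∀ k, eLpNorm (φ k) q μ ≤ M)
    (hbound' : ∀ k, eLpNorm (fderiv ℝ (φ k)) q μ ≤ M)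
    (hlim : ∀ S, MeasurableSet S → Tendsto (fun k => ∫ x in S, φ k x ∂μ) atTop (𝓝 0)) :
    Tendsto (fun k => eLpNorm (φ k) q μ) atTop (𝓝 0) := by
  rw [ENNReal.tendsto_nhds_zero]
  intro c hc0
  obtain ⟨δ, hδ, hδM⟩ := ENNReal.exists_nnreal_pos_mul_lt hM (ENNReal.half_pos hc0.ne').ne'
  have hB0 : μ (Metric.ball 0 δ) ≠ 0 := (Metric.measure_ball_pos μ _ (NNReal.coe_pos.2 hδ)).ne'
  have hB_top : μ (Metric.ball 0 δ) ≠ ⊤ := measure_ball_lt_top.ne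
  have := ProbabilityTheory.cond_isProbabilityMeasure_of_finite hB0 hB_top
  have hB_norm : ∀ᵐ h ∂μ[|Metric.ball 0 δ], ‖h‖ₑ ≤ δ := by
    filter_upwards [ProbabilityTheory.ae_cond_mem Metric.isOpen_ball.measurableSet] with h hh
    exact enorm_le_coe.2 (mem_ball_zero_iff.1 hh).le
  have havg := tendsto_eLpNorm_average hq hq' hΩ Metric.isOpen_ball.measurableSet hB0 hB_top
    (fun k => (hφ k).continuous) hM hbound hlim
  filter_upwards [havg.eventually_lt_const (ENNReal.half_pos hc0.ne')] with k hk
  calc eLpNorm (φ k) q μ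
      ≤ δ * eLpNorm (fderiv ℝ (φ k)) q μ + eLpNorm (fun x => ∫ h, φ k (x + h) ∂μ[|Metric.ball 0 δ])
          q (μ.restrict Ω) :=
        eLpNorm_le_mul_fderiv_add_average hq hq' (hφ k) (hc k) (hsupp k) hB_norm
    _ ≤ δ * M + c / 2 := by gcongr; exact hbound' k
    _ ≤ c / 2 + c / 2 := by gcongr
    _ = c := ENNReal.add_halves c

end VanishingAverages

section Rellich

variable {d : ℕ} {Ω : Set (Dom d)}

lemma IsTestFunction.support_gradient_subset {φ : Dom d → ℝ} (hφ : IsTestFunction Ω φ) :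
    Function.support (∇ φ) ⊆ Ω := by
  intro x hx
  have hfderiv : fderiv ℝ φ x ≠ 0 := fun h => hx (by simp [gradient, h])
  exact hφ.2.2 (support_fderiv_subset ℝ hfderiv)

theorem tendsto_fst_of_mem_testGraph (hΩ : volume Ω ≠ ⊤) {v : ℕ → GraphSpace Ω}
    (hv : ∀ k, v k ∈ testGraph Ω) {M : ℝ} (hM : ∀ k, ‖v k‖ ≤ M)
    (hlim : ∀ g : Lp ℝ 2 (volume.restrict Ω), Tendsto (fun k => ⟪g, (v k).fst⟫) atTop (𝓝 0)) :
    Tendsto (fun k => (v k).fst) atTop (𝓝 0) := by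
  choose φ hφ hfst hsnd using hv
  have hsupp (k : ℕ) : Function.support (φ k) ⊆ Ω := (subset_tsupport _).trans (hφ k).2.2
  have hnorm (k : ℕ) : ‖(v k).fst‖ₑ = eLpNorm (φ k) 2 volume :=
    enorm_eq_eLpNorm_of_ae_eq (hfst k) (hsupp k)
  have hnorm' (k : ℕ) : ‖(v k).snd‖ₑ = eLpNorm (fderiv ℝ (φ k)) 2 volume := by
    rw [enorm_eq_eLpNorm_of_ae_eq (hsnd k) (hφ k).support_gradient_subset]
    exact eLpNorm_congr_norm_ae (Eventually.of_forall fun x => by simp [gradient])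
  have hMe (k : ℕ) : ‖v k‖ₑ ≤ ENNReal.ofReal M := by
    rw [← ofReal_norm]
    exact ENNReal.ofReal_le_ofReal (hM k)
  have hfst_lim : Tendsto (fun k => ‖(v k).fst‖ₑ) atTop (𝓝 0) := by
    simp only [hnorm]
    refine tendsto_eLpNorm_of_tendsto_setIntegral one_le_two ENNReal.ofNat_ne_top hΩ
      (fun k => (hφ k).1.of_le (by exact_mod_cast le_top)) (fun k => (hφ k).2.1) hsupp
      ENNReal.ofReal_ne_top
      (fun k => (hnorm k).symm.trans_le ((WithLp.enorm_fst_le _ _).trans (hMe k)))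
      (fun k => (hnorm' k).symm.trans_le ((WithLp.enorm_snd_le _ _).trans (hMe k)))
      fun S hS => ?_
    have hS_top : (volume.restrict Ω) S ≠ ⊤ :=
      ((measure_mono (Set.subset_univ S)).trans_lt (by simpa [lt_top_iff_ne_top] using hΩ)).ne
    refine (hlim (indicatorConstLp 2 hS hS_top 1)).congr fun k => ?_
    rw [L2.inner_indicatorConstLp_one, integral_congr_ae (ae_restrict_of_ae (hfst k)),
      Measure.restrict_restrict hS]
    refine (setIntegral_eq_of_subset_of_forall_sdiff_eq_zero hS Set.inter_subset_left
      fun x hx => ?_).symm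
    exact Function.notMem_support.1 fun hxφ => hx.2 ⟨hx.1, hsupp k hxφ⟩
  exact tendsto_zero_iff_enorm_tendsto_zero.2 hfst_lim

theorem tendsto_fst_of_mem_H01 (hΩ : volume Ω ≠ ⊤) {w : ℕ → H01 Ω} {M : ℝ} (hM : ∀ k, ‖w k‖ ≤ M)
    (hlim : ∀ g : Lp ℝ 2 (volume.restrict Ω),
      Tendsto (fun k => ⟪g, (w k : GraphSpace Ω).fst⟫) atTop (𝓝 0)) :
    Tendsto (fun k => (w k : GraphSpace Ω).fst) atTop (𝓝 0) := by
  have happrox (k : ℕ) : ∃ v ∈ testGraph Ω, dist (w k : GraphSpace Ω) v < 1 / ((k : ℝ) + 1) :=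
    Metric.mem_closure_iff.1 (w k).2 _ (by positivity)
  choose v hv hdist using happrox
  have hsub : Tendsto (fun k => (w k : GraphSpace Ω) - v k) atTop (𝓝 0) :=
    squeeze_zero_norm (fun k => dist_eq_norm (w k : GraphSpace Ω) (v k) ▸ (hdist k).le)
      tendsto_one_div_add_atTop_nhds_zero_nat
  have hsub_fst : Tendsto (fun k => (w k : GraphSpace Ω).fst - (v k).fst) atTop (𝓝 0) :=
    (WithLp.fstL 2 ℝ _ _).continuous.tendsto' 0 0 (map_zero _) |>.comp hsub
  have hvM (k : ℕ) : ‖v k‖ ≤ M + 1 := by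
    have hk : 1 / ((k : ℝ) + 1) ≤ 1 := div_le_one_of_le₀ (by simp) (by positivity)
    calc ‖v k‖ ≤ ‖(w k : GraphSpace Ω)‖ + ‖(w k : GraphSpace Ω) - v k‖ :=
          norm_le_norm_add_norm_sub _ _
      _ ≤ M + 1 := add_le_add (hM k) (dist_eq_norm (w k : GraphSpace Ω) (v k) ▸
          (hdist k).le.trans hk)
  have hv_lim := tendsto_fst_of_mem_testGraph hΩ hv hvM fun g => by
    simpa [inner_sub_right] using (hlim g).sub
      (((innerSL ℝ g).continuous.tendsto' 0 0 (map_zero _)).comp hsub_fst)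
  simpa using hv_lim.add hsub_fst

end Rellich

/-- The inner product as a bilinear form. Mathlib's `innerSL ℝ` is typed as a sesquilinear map, and
so cannot be added to a bilinear form. -/
def innerForm (U : Type*) [NormedAddCommGroup U] [InnerProductSpace ℝ U] :
    U →L[ℝ] U →L[ℝ] ℝ :=
  innerSL ℝ

section QuadraticProx

variable {U : Type*} [NormedAddCommGroup U] [InnerProductSpace ℝ U]
  {r K : ℝ} {B : U →L[ℝ] U →L[ℝ] ℝ} {Φ : U → ℝ}

lemma eq_zero_of_forall_quadratic_nonneg {b c : ℝ} (h : ∀ t : ℝ, 0 ≤ t * b + t ^ 2 * c) :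
    b = 0 := by
  have hdiscrim : discrim c b 0 ≤ 0 := discrim_le_zero fun t => by linarith [h t, pow_two t]
  simp only [discrim, mul_zero, sub_zero] at hdiscrim
  exact pow_eq_zero_iff two_ne_zero |>.1 (le_antisymm hdiscrim (sq_nonneg b))

lemma prox_objective_add (hB : ∀ u v, B u v = B v u) (hΦ : ∀ v, Φ v = K + B v v / 2) (z y s : U) :
    1 / (2 * r) * ‖y + s - z‖ ^ 2 + Φ (y + s) =
      1 / (2 * r) * ‖y - z‖ ^ 2 + Φ y + (1 / r * ⟪y - z, s⟫ + B y s) +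
        (1 / (2 * r) * ‖s‖ ^ 2 + B s s / 2) := by
  rw [add_sub_right_comm, hΦ, hΦ, norm_add_sq_real]
  simp only [map_add, _root_.add_apply]
  rw [hB s y]
  field_simp
  ring

lemma isProx_iff_of_quadratic (hr : 0 ≤ r) (hB : ∀ u v, B u v = B v u) (hB0 : ∀ u, 0 ≤ B u u)
    (hΦ : ∀ v, Φ v = K + B v v / 2) (z y : U) :
    IsProx r Φ z y ↔ ∀ s, 1 / r * ⟪y - z, s⟫ + B y s = 0 := by
  refine ⟨fun h s => ?_, fun h v => ?_⟩
  · refine eq_zero_of_forall_quadratic_nonneg (c := 1 / (2 * r) * ‖s‖ ^ 2 + B s s / 2) fun t => ?_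
    have hle := h (y + t • s)
    rw [prox_objective_add hB hΦ] at hle
    simp only [map_smul, _root_.smul_apply, smul_eq_mul, inner_smul_right, norm_smul,
      mul_pow, Real.norm_eq_abs, sq_abs] at hle
    linarith
  · have hexp := prox_objective_add (r := r) hB hΦ z y (v - y)
    rw [add_sub_cancel, h] at hexp
    have hsq : 0 ≤ 1 / (2 * r) * ‖v - y‖ ^ 2 := by positivity
    linarith [hB0 (v - y)]

variable [CompleteSpace U]

lemma exists_isProx_of_quadratic (hr : 0 < r) (hB : ∀ u v, B u v = B v u) (hB0 : ∀ u, 0 ≤ B u u)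
    (hΦ : ∀ v, Φ v = K + B v v / 2) (z : U) : ∃ y, IsProx r Φ z y := by
  let C : U →L[ℝ] U →L[ℝ] ℝ := (1 / r) • innerForm U + B
  have hC : ∀ u v, C u v = 1 / r * ⟪u, v⟫ + B u v := fun u v => rfl
  have hcoercive : IsCoercive C := ⟨1 / r, by positivity, fun u => by
    rw [hC, real_inner_self_eq_norm_sq]
    linarith [hB0 u]⟩
  refine ⟨hcoercive.continuousLinearEquivOfBilin.symm ((1 / r) • z),
    (isProx_iff_of_quadratic hr.le hB hB0 hΦ z _).2 fun s => ?_⟩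
  have hsolves := hcoercive.continuousLinearEquivOfBilin_apply
    (hcoercive.continuousLinearEquivOfBilin.symm ((1 / r) • z)) s
  rw [ContinuousLinearEquiv.apply_symm_apply, real_inner_smul_left, hC] at hsolves
  rw [inner_sub_left]
  linarith

theorem prox_quadratic_eq (hr : 0 < r) (hB : ∀ u v, B u v = B v u) (hB0 : ∀ u, 0 ≤ B u u)
    (hΦ : ∀ v, Φ v = K + B v v / 2) (z v : U) :
    1 / r * ⟪prox r Φ z - z, v⟫ + B (prox r Φ z) v = 0 :=
  (isProx_iff_of_quadratic hr.le hB hB0 hΦ z _).1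
    (Classical.epsilon_spec (exists_isProx_of_quadratic hr hB hB0 hΦ z)) v

end QuadraticProx

section Majorant

variable {d : ℕ} {Ω : Set (Dom d)} {U : Type*} [NormedAddCommGroup U] [InnerProductSpace ℝ U]
  (e : U ≃L[ℝ] H01 Ω)

/-- The inclusion of `U = H_0^1(Ω)` into `L²(Ω)`; the representative of `toL2 e u` is `(e u).fn`. -/
def toL2 : U →L[ℝ] Lp ℝ 2 (volume.restrict Ω) :=
  (WithLp.fstL 2 ℝ (Lp ℝ 2 (volume.restrict Ω)) (Lp (Dom d) 2 (volume.restrict Ω))).comp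
    ((testGraph Ω).topologicalClosure.subtypeL.comp (e : U →L[ℝ] H01 Ω))

variable {p ε : ℝ} (hp : 0 < p) (hp2 : p ≤ 2) (hε : 0 < ε) (α β : ℝ) (w : U)

/-- The symmetric bilinear form `2 β ∫ ψ_ε'(w²) a b + α (a, b)` on `U`, which is the second
derivative of the majorant `phiMaj` at `w`. -/
def majorantForm : U →L[ℝ] U →L[ℝ] ℝ :=
  (2 * β) • (psiForm hp hp2 hε (toL2 e w)).bilinearComp (toL2 e) (toL2 e) +
    α • innerForm U

lemma majorantForm_apply (a b : U) : majorantForm e hp hp2 hε α β w a b =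
    2 * β * psiForm hp hp2 hε (toL2 e w) (toL2 e a) (toL2 e b) + α * ⟪a, b⟫ := rfl

lemma phiMaj_eq_const_add_majorantForm (hΩ : volume Ω ≠ ⊤) (v : U) :
    phiMaj e p α β ε w v =
      β * ((∫ x in Ω, psi p ε (toL2 e w x ^ 2)) -
        psiForm hp hp2 hε (toL2 e w) (toL2 e w) (toL2 e w)) +
      majorantForm e hp hp2 hε α β w v v / 2 := by
  have : IsFiniteMeasure (volume.restrict Ω) := isFiniteMeasure_restrict.2 hΩ
  have hmaj : jMaj e p ε w v = _ := integral_psi_majorant hp hp2 hε (toL2 e w) (toL2 e v)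
  rw [phiMaj, hmaj, majorantForm_apply, real_inner_self_eq_norm_sq]
  ring

variable {α β}

theorem prox_phiMaj_eq [CompleteSpace U] (hΩ : volume Ω ≠ ⊤) (hα : 0 ≤ α) (hβ : 0 ≤ β) {r : ℝ}
    (hr : 0 < r) {g P : U} (hP : P = prox r (phiMaj e p α β ε w) (w - r • g)) (v : U) :
    1 / r * ⟪P - w, v⟫ + ⟪g, v⟫ + α * ⟪P, v⟫ +
      β * (2 * psiForm hp hp2 hε (toL2 e w) (toL2 e P) (toL2 e v)) = 0 := by
  have hprox := prox_quadratic_eq hr (B := majorantForm e hp hp2 hε α β w)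
    (fun a b => by simp only [majorantForm_apply, psiForm_comm, real_inner_comm])
    (fun a => by
      rw [majorantForm_apply]
      have := psiForm_self_nonneg hp hp2 hε (toL2 e w) (toL2 e a)
      have := real_inner_self_nonneg (x := a)
      positivity)
    (phiMaj_eq_const_add_majorantForm e hp hp2 hε α β w hΩ) (w - r • g) v
  rw [← hP, majorantForm_apply, ← sub_add, inner_add_left, real_inner_smul_left, mul_add,
    ← mul_assoc, one_div_mul_cancel hr.ne'] at hprox
  linarith

end Majorant

section WeakConvergence

variable {U : Type*} [NormedAddCommGroup U] [InnerProductSpace ℝ U] {u v : ℕ → U} {a b : U}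

lemma WeaklyTendsto.apply (h : WeaklyTendsto u a) (l : StrongDual ℝ U) :
    Tendsto (fun k => l (u k)) atTop (𝓝 (l a)) :=
  ((WeakBilin.eval_continuous (topDualPairing ℝ U).flip l).tendsto _).comp h

lemma WeaklyTendsto.inner_left (h : WeaklyTendsto u a) (b : U) :
    Tendsto (fun k => ⟪b, u k⟫) atTop (𝓝 ⟪b, a⟫) :=
  h.apply (innerSL ℝ b)

lemma WeaklyTendsto.exists_norm_le [CompleteSpace U] (h : WeaklyTendsto u a) :
    ∃ M, ∀ k, ‖u k‖ ≤ M := by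
  obtain ⟨M, hM⟩ := banach_steinhaus (g := fun k => innerSL ℝ (u k)) fun b => by
    obtain ⟨C, hC⟩ := (h.inner_left b).norm.bddAbove_range
    refine ⟨C, fun k => ?_⟩
    rw [innerSL_apply_apply, real_inner_comm]
    exact hC (Set.mem_range_self k)
  exact ⟨M, fun k => by simpa using hM k⟩

lemma tendsto_inner_zero_of_norm_le {M : ℝ} (hM : ∀ k, ‖u k‖ ≤ M) (hv : Tendsto v atTop (𝓝 0)) :
    Tendsto (fun k => ⟪u k, v k⟫) atTop (𝓝 0) := by
  refine squeeze_zero_norm (a := fun k => M * ‖v k‖)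
    (fun k => (norm_inner_le_norm _ _).trans (by gcongr; exact hM k)) ?_
  simpa using hv.norm.const_mul M

lemma WeaklyTendsto.inner_tendsto [CompleteSpace U] (h : WeaklyTendsto u a)
    (hv : Tendsto v atTop (𝓝 b)) : Tendsto (fun k => ⟪v k, u k⟫) atTop (𝓝 ⟪b, a⟫) := by
  obtain ⟨M, hM⟩ := h.exists_norm_le
  have hdiff := tendsto_inner_zero_of_norm_le hM (tendsto_sub_nhds_zero_iff.2 hv)
  simpa [inner_sub_right, real_inner_comm] using hdiff.add (h.inner_left b)

lemma weaklyTendsto_of_tendsto (h : Tendsto u atTop (𝓝 a)) : WeaklyTendsto u a :=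
  ((toWeakSpaceCLM ℝ U).continuous.tendsto a).comp h

lemma WeaklyTendsto.of_sub_tendsto_zero (h : WeaklyTendsto u a)
    (hvu : Tendsto (fun k => v k - u k) atTop (𝓝 0)) : WeaklyTendsto v a := by
  have hadd := Filter.Tendsto.add (weaklyTendsto_of_tendsto hvu) h
  simpa only [WeaklyTendsto, ← map_add, sub_add_cancel, zero_add] using hadd

lemma WeaklyTendsto.mul_norm_sq_le (h : WeaklyTendsto u a) {α c : ℝ} (hα : 0 ≤ α)
    (hc : Tendsto (fun k => α * ‖u k‖ ^ 2) atTop (𝓝 c)) : α * ‖a‖ ^ 2 ≤ c := by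
  have hlin := (((h.inner_left a).const_mul 2).sub_const (‖a‖ ^ 2)).const_mul α
  rw [real_inner_self_eq_norm_sq, two_mul, add_sub_cancel_right] at hlin
  refine le_of_tendsto_of_tendsto' hlin hc fun k => mul_le_mul_of_nonneg_left ?_ hα
  linarith [norm_sub_sq_real a (u k), sq_nonneg ‖a - u k‖]

theorem WeaklyTendsto.tendsto_toL2 [CompleteSpace U] {d : ℕ} {Ω : Set (Dom d)} (e : U ≃L[ℝ] H01 Ω)
    (hΩ : volume Ω ≠ ⊤) (h : WeaklyTendsto u a) :
    Tendsto (fun k => toL2 e (u k)) atTop (𝓝 (toL2 e a)) := by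
  obtain ⟨M, hM⟩ := h.exists_norm_le
  refine tendsto_sub_nhds_zero_iff.1 ?_
  simp_rw [← map_sub]
  refine tendsto_fst_of_mem_H01 hΩ (w := fun k => e (u k - a))
    (M := ‖(e : U →L[ℝ] H01 Ω)‖ * (M + ‖a‖)) (fun k => ?_) fun g => ?_
  · refine (e : U →L[ℝ] H01 Ω).le_opNorm_of_le ((norm_sub_le _ _).trans ?_)
    gcongr
    exact hM k
  · have hdual : Tendsto (fun k => ⟪g, toL2 e (u k - a)⟫) atTop (𝓝 0) := by
      simpa [inner_sub_right] using
        (h.apply ((innerSL ℝ g).comp (toL2 e))).sub_const (⟪g, toL2 e a⟫)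
    exact hdual

end WeakConvergence

section Smoothness

variable {U : Type*} [NormedAddCommGroup U] [InnerProductSpace ℝ U] [CompleteSpace U]
  {L : ℝ≥0} {f : U → ℝ}

lemma IsLSmooth.norm_gradient_le (hf : IsLSmooth L f) (u : U) :
    ‖∇ f u‖ ≤ ‖∇ f 0‖ + L * ‖u‖ := by
  have hdist := hf.2.dist_le_mul u 0
  rw [dist_eq_norm, dist_zero_right] at hdist
  linarith [norm_sub_norm_le (∇ f u) (∇ f 0)]

lemma IsLSmooth.abs_sub_sub_le (hf : IsLSmooth L f) (u s : U) :
    |f (u + s) - f u - ⟪∇ f u, s⟫| ≤ L * ‖s‖ ^ 2 := by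
  have hmean := Convex.norm_image_sub_le_of_norm_fderiv_le' (𝕜 := ℝ) (f := f) (C := L * ‖s‖)
    (s := Metric.closedBall u ‖s‖) (x := u) (y := u + s) (φ := fderiv ℝ f u)
    (fun x _ => hf.1 x) (fun x hx => ?_) (convex_closedBall _ _) (by simp) (by simp)
  · rw [add_sub_cancel_left, ← inner_gradient_left, Real.norm_eq_abs] at hmean
    rwa [pow_two, ← mul_assoc]
  · have hdual : fderiv ℝ f x - fderiv ℝ f u = InnerProductSpace.toDual ℝ U (∇ f x - ∇ f u) := by
      simp [gradient]
    rw [hdual, LinearIsometryEquiv.norm_map, ← dist_eq_norm]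
    exact (hf.2.dist_le_mul x u).trans (by gcongr; exact hx)

lemma IsLSmooth.abs_curvature_le (hf : IsLSmooth L f) (u s : U) : |curvature f u s| ≤ 2 * L := by
  rw [curvature, abs_mul, abs_of_nonneg (by positivity), div_mul_eq_mul_div]
  refine div_le_of_le_mul₀ (by positivity) (by positivity) ?_
  linarith [hf.abs_sub_sub_le u s]

end Smoothness

section Stationarity

variable {U : Type*} [NormedAddCommGroup U] [InnerProductSpace ℝ U]

lemma tendsto_prox_sub_of_tendsto_proxResidual {r : ℝ} (hr : r ≠ 0) {Φ : ℕ → U → ℝ} {u g : ℕ → U}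
    (h : Tendsto (fun k => proxResidual r (Φ k) (g k) (u k)) atTop (𝓝 0)) :
    Tendsto (fun k => prox r (Φ k) (u k - r • g k) - u k) atTop (𝓝 0) := by
  rw [tendsto_zero_iff_norm_tendsto_zero]
  simpa only [proxResidual, ← mul_assoc, mul_one_div_cancel hr, one_mul, mul_zero]
    using h.const_mul r

/-- The multiplier `λ̄ = -(f'(ū) + α ū) / β`, which solves the stationarity equation
`α (ū, v) + β ⟨λ̄, v⟩ = -f'(ū) v`. -/
def multiplier (f : U → ℝ) (α β : ℝ) (ubar : U) : StrongDual ℝ U :=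
  -β⁻¹ • (fderiv ℝ f ubar + α • innerSL ℝ ubar)

lemma multiplier_stationary (f : U → ℝ) (α : ℝ) {β : ℝ} (hβ : β ≠ 0) (ubar v : U) :
    α * ⟪ubar, v⟫ + β * multiplier f α β ubar v = -(fderiv ℝ f ubar v) := by
  simp only [multiplier, neg_smul, _root_.neg_apply, _root_.smul_apply, _root_.add_apply,
    innerSL_apply_apply, smul_eq_mul, mul_neg, mul_inv_cancel_left₀ hβ]
  ring

variable [CompleteSpace U] {d : ℕ} {Ω : Set (Dom d)} (e : U ≃L[ℝ] H01 Ω) {p α β r : ℝ}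
  {ε : ℕ → ℝ} {u g P : ℕ → U} {ubar gbar : U}
  (hΩ : volume Ω ≠ ⊤) (hp : 0 < p) (hp2 : p ≤ 2) (hα : 0 ≤ α) (hβ : 0 < β) (hr : 0 < r)
  (hε : ∀ k, 0 < ε k) (hε0 : Tendsto ε atTop (𝓝 0))
  (hP : ∀ k, P k = prox r (phiMaj e p α β (ε k) (u k)) (u k - r • g k))
  (hPu : Tendsto (fun k => P k - u k) atTop (𝓝 0))

include hΩ hα hβ hr hε0 hP hPu

/- Testing the equation of the proximal point with `P k - u k` makes every term but the weighted one
small, which is the hypothesis of `tendsto_psiForm_self`. -/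
theorem tendsto_psiForm_prox (hu : WeaklyTendsto u ubar) {G : ℝ} (hG : ∀ k, ‖g k‖ ≤ G) :
    Tendsto (fun k => 2 * psiForm hp hp2 (hε k) (toL2 e (u k)) (toL2 e (P k)) (toL2 e (P k))) atTop
      (𝓝 (p * lpPseudo e p ubar)) := by
  have : IsFiniteMeasure (volume.restrict Ω) := isFiniteMeasure_restrict.2 hΩ
  have hPw : WeaklyTendsto P ubar := hu.of_sub_tendsto_zero hPu
  obtain ⟨M, hM⟩ := hPw.exists_norm_le
  have hform : Tendsto (fun k => psiForm hp hp2 (hε k) (toL2 e (u k)) (toL2 e (P k))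
      (toL2 e (P k) - toL2 e (u k))) atTop (𝓝 0) := by
    have hsum := ((((hPu.inner (𝕜 := ℝ) hPu).const_mul (1 / r)).add
      (tendsto_inner_zero_of_norm_le hG hPu)).add
      ((tendsto_inner_zero_of_norm_le hM hPu).const_mul α)).const_mul (-(2 * β)⁻¹)
    simp only [inner_zero_left, mul_zero, add_zero] at hsum
    refine hsum.congr fun k => ?_
    have heq := prox_phiMaj_eq e hp hp2 (hε k) (u k) hΩ hα hβ.le hr (hP k) (P k - u k)
    rw [eq_neg_of_add_eq_zero_left heq, map_sub]
    field_simp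
  have hlim := (tendsto_psiForm_self hp hp2 hε hε0 (hu.tendsto_toL2 e hΩ) (hPw.tendsto_toL2 e hΩ)
    hform).const_mul 2
  rwa [← mul_assoc, mul_div_cancel₀ p two_ne_zero] at hlim

include hp hp2 hε

lemma tendsto_mul_norm_prox_sq (hu : WeaklyTendsto u ubar) (hg : Tendsto g atTop (𝓝 gbar)) :
    Tendsto (fun k => α * ‖P k‖ ^ 2) atTop
      (𝓝 (-⟪gbar, ubar⟫ - β * (p * lpPseudo e p ubar))) := by
  have hPw : WeaklyTendsto P ubar := hu.of_sub_tendsto_zero hPu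
  obtain ⟨G, hG⟩ := hg.norm.bddAbove_range
  have hform := tendsto_psiForm_prox e hΩ hp hp2 hα hβ hr hε hε0 hP hPu hu
    fun k => hG (Set.mem_range_self k)
  have hsum := (((hPw.inner_tendsto hPu).const_mul (1 / r)).add (hPw.inner_tendsto hg)).neg.sub
    (hform.const_mul β)
  rw [inner_zero_left, mul_zero, zero_add] at hsum
  refine hsum.congr fun k => ?_
  have heq := prox_phiMaj_eq e hp hp2 (hε k) (u k) hΩ hα hβ.le hr (hP k) (P k)
  rw [real_inner_self_eq_norm_sq] at heq
  linarith

variable {f : U → ℝ} (hg : Tendsto g atTop (𝓝 (∇ f ubar)))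

include hg

theorem le_multiplier_self_of_weaklyTendsto (hu : WeaklyTendsto u ubar) :
    p * lpPseudo e p ubar ≤ multiplier f α β ubar ubar := by
  have hnorm := (hu.of_sub_tendsto_zero hPu).mul_norm_sq_le hα
    (tendsto_mul_norm_prox_sq e hΩ hp hp2 hα hβ hr hε hε0 hP hPu hu hg)
  have hstat := multiplier_stationary f α hβ.ne' ubar ubar
  rw [real_inner_self_eq_norm_sq, ← inner_gradient_left] at hstat
  exact le_of_mul_le_mul_left (by linarith) hβ

theorem multiplier_self_of_tendsto (hu : Tendsto u atTop (𝓝 ubar)) :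
    multiplier f α β ubar ubar = p * lpPseudo e p ubar := by
  have hPs : Tendsto P atTop (𝓝 ubar) := by simpa using hPu.add hu
  have hnorm := tendsto_nhds_unique ((hPs.norm.pow 2).const_mul α)
    (tendsto_mul_norm_prox_sq e hΩ hp hp2 hα hβ hr hε hε0 hP hPu (weaklyTendsto_of_tendsto hu) hg)
  have hstat := multiplier_stationary f α hβ.ne' ubar ubar
  rw [real_inner_self_eq_norm_sq, ← inner_gradient_left] at hstat
  exact mul_left_cancel₀ hβ.ne' (by linarith)

end Stationarity

section TrustRegion

lemma min_rpow_le {a t ζ : ℝ} (ha : 0 ≤ a) (ht : 0 ≤ t) (hζ : 1 ≤ ζ) :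
    min a t ^ ζ ≤ t ^ (ζ - 1) * a := by
  have hmin : 0 ≤ min a t := le_min ha ht
  calc min a t ^ ζ = min a t ^ (ζ - 1) * min a t := by
        rw [← Real.rpow_add_one' hmin (by linarith), sub_add_cancel]
    _ ≤ t ^ (ζ - 1) * a := mul_le_mul (Real.rpow_le_rpow hmin (min_le_right _ _) (by linarith))
        (min_le_left _ _) hmin (Real.rpow_nonneg ht _)

namespace Data

section Curvature

variable {U : Type*} [NormedAddCommGroup U] [InnerProductSpace ℝ U] [CompleteSpace U] (D : Data U)

lemma omega_nonneg (k : ℕ) : 0 ≤ D.omega k := by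
  refine Real.sSup_nonneg ?_
  rintro _ ⟨s, _, _, rfl⟩
  exact abs_nonneg _

lemma one_add_omega_le_b {k : ℕ} (hk : 1 ≤ k) : 1 + D.omega k ≤ D.b k := by
  rw [b]
  gcongr
  exact le_csSup ((Set.finite_Icc 1 k).image _).bddAbove ⟨k, ⟨hk, le_rfl⟩, rfl⟩

lemma one_le_b (k : ℕ) : 1 ≤ D.b k := by
  refine le_add_of_nonneg_right (Real.sSup_nonneg ?_)
  rintro _ ⟨i, _, rfl⟩
  exact D.omega_nonneg i

variable {D} in
lemma abs_model_sub_le {k : ℕ} {L : ℝ≥0} (hL : IsLSmooth L (D.model k)) {s : U}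
    (hs : ‖s‖ ≤ D.κrad * D.Δ k) :
    |D.model k (D.u k + s) - D.model k (D.u k) - ⟪∇ (D.model k) (D.u k), s⟫| ≤
      D.omega k * ‖s‖ ^ 2 := by
  rcases (norm_nonneg s).eq_or_lt with hzero | hpos
  · simp [norm_eq_zero.1 hzero.symm]
  have hcurv : |curvature (D.model k) (D.u k) s| ≤ D.omega k := by
    refine le_csSup ⟨2 * L, ?_⟩ ⟨s, hpos, hs, rfl⟩
    rintro _ ⟨t, _, _, rfl⟩
    exact hL.abs_curvature_le _ t
  rw [curvature, abs_mul, abs_of_nonneg (by positivity), div_mul_eq_mul_div,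
    div_le_iff₀ (by positivity)] at hcurv
  linarith [abs_nonneg
    (D.model k (D.u k + s) - D.model k (D.u k) - ⟪∇ (D.model k) (D.u k), s⟫)]

variable {D} in
lemma CurvatureCondition.frequently_lt (hb : D.CurvatureCondition) (hΔ : Summable D.Δ) {δ : ℝ}
    (hδ : 0 < δ) : ∃ᶠ k in atTop, D.b k * D.Δ k < δ := by
  intro hge
  have hpos : ∀ k, 0 < D.b k := fun k => one_pos.trans_le (D.one_le_b k)
  have hnonneg : ∀ k, 0 ≤ 1 / D.b k := fun k => one_div_nonneg.2 (hpos k).le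
  have hsum : Summable fun k => 1 / D.b k := by
    refine (hΔ.mul_left δ⁻¹).of_norm_bounded_eventually_nat ?_
    filter_upwards [hge] with k hk
    rw [Real.norm_of_nonneg (hnonneg k), div_le_iff₀ (hpos k), mul_assoc,
      mul_comm (D.Δ k), ← div_eq_inv_mul, le_div_iff₀ hδ, one_mul]
    exact not_lt.1 hk
  obtain ⟨n, hn⟩ := (hb.eventually_gt_atTop (∑' k, 1 / D.b k)).exists
  exact absurd hn (not_lt.2 (hsum.sum_le_tsum _ fun k _ => hnonneg k))

end Curvature

variable {d : ℕ} {Ω : Set (Dom d)} {U : Type*} [NormedAddCommGroup U] [InnerProductSpace ℝ U]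
  {D : Data U} {e : U ≃L[ℝ] H01 Ω} {p α β : ℝ} {f : U → ℝ}

lemma one_sub_add_le_rho {k : ℕ} {c c' : ℝ} (hpos : 0 < D.pred e p α β k)
    (hpred : |D.ared e p α β f k - D.pred e p α β k| ≤ c * D.pred e p α β k)
    (hcred : |D.ared e p α β f k - D.cred k| ≤ c' * D.pred e p α β k) :
    1 - (c + c') ≤ D.rho e p α β k := by
  rw [rho, le_div_iff₀ hpos]
  linarith [(abs_le.1 hpred).1, (abs_le.1 hcred).2]

lemma InexactObjective.exists_tendsto_zero (hobj : D.InexactObjective e p α β f) :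
    ∃ δ : ℕ → ℝ, Tendsto δ atTop (𝓝 0) ∧ ∀ k, 0 ≤ D.pred e p α β k →
      |D.ared e p α β f k - D.cred k| ≤ δ k * D.pred e p α β k := by
  obtain ⟨κobj, η, ζ, θ, hκobj, hζ, hη, -, hθ, hθ0, hcred⟩ := hobj
  refine ⟨fun k => κobj * η ^ ζ * θ k ^ (ζ - 1), ?_, fun k hpred => ?_⟩
  · have hlim := (hθ0.rpow_const (p := ζ - 1) (Or.inr (by linarith))).const_mul (κobj * η ^ ζ)
    rwa [Real.zero_rpow (by linarith), mul_zero] at hlim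
  · calc |D.ared e p α β f k - D.cred k|
        ≤ κobj * (η * min (D.pred e p α β k) (θ k)) ^ ζ := hcred k
      _ = κobj * η ^ ζ * min (D.pred e p α β k) (θ k) ^ ζ := by
        rw [Real.mul_rpow hη.le (le_min hpred (hθ k)), mul_assoc]
      _ ≤ κobj * η ^ ζ * (θ k ^ (ζ - 1) * D.pred e p α β k) := by
        gcongr
        exact min_rpow_le hpred (hθ k) hζ.le
      _ = κobj * η ^ ζ * θ k ^ (ζ - 1) * D.pred e p α β k := by ring

variable [CompleteSpace U]

lemma ared_sub_pred_eq (k : ℕ) {s : U} (hs : D.trial k = D.u k + s) :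
    D.ared e p α β f k - D.pred e p α β k =
      (D.model k (D.u k + s) - D.model k (D.u k) - ⟪∇ (D.model k) (D.u k), s⟫) -
      (f (D.u k + s) - f (D.u k) - ⟪∇ f (D.u k), s⟫) +
      ⟪∇ (D.model k) (D.u k) - ∇ f (D.u k), s⟫ := by
  rw [ared, pred, mod, mod, hs, inner_sub_left]
  ring

lemma InexactGradient.tendsto_gradient_sub (hgrad : D.InexactGradient e p α β f) {σ : ℕ → ℕ}
    (hh : Tendsto (fun n => D.h e p α β (σ n)) atTop (𝓝 0)) :
    Tendsto (fun n => ∇ (D.model (σ n)) (D.u (σ n)) - ∇ f (D.u (σ n))) atTop (𝓝 0) := by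
  obtain ⟨-, κ, hκ, hg⟩ := hgrad
  refine squeeze_zero_norm (fun n => (hg (σ n)).trans ?_) (by simpa using hh.const_mul κ)
  gcongr
  exact min_le_left _ _

namespace IsRun

lemma h_nonneg (hD : D.IsRun e p α β) (k : ℕ) : 0 ≤ D.h e p α β k :=
  mul_nonneg (one_div_nonneg.2 hD.r₀_pos.le) (norm_nonneg _)

lemma γ₂_pos (hD : D.IsRun e p α β) : 0 < D.γ₂ := hD.γ₁_pos.trans_le hD.γ₁_le_γ₂

lemma Δ_pos (hD : D.IsRun e p α β) (k : ℕ) : 0 < D.Δ k := by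
  induction k with
  | zero => exact hD.Δ_zero_pos
  | succ k ih =>
    rcases lt_or_ge (D.rho e p α β k) D.η₁ with hfail | hsucc
    · exact (mul_pos hD.γ₁_pos ih).trans_le (hD.radius_unsuccessful k hfail).1
    rcases lt_or_ge (D.rho e p α β k) D.η₂ with hmoderate | hvery
    · exact (mul_pos hD.γ₂_pos ih).trans_le (hD.radius_successful k hsucc hmoderate).1
    · exact ih.trans_le (hD.radius_very_successful k hvery).1

lemma abs_ared_sub_pred_le (hD : D.IsRun e p α β) {L : ℝ≥0} (hf : IsLSmooth L f) {κ : ℝ}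
    (hκ : 0 ≤ κ) {k : ℕ} {Lk : ℝ≥0} (hm : IsLSmooth Lk (D.model k))
    (hg : ‖∇ (D.model k) (D.u k) - ∇ f (D.u k)‖ ≤ κ * D.Δ k) :
    |D.ared e p α β f k - D.pred e p α β k| ≤
      ((D.omega k + L) * D.κrad ^ 2 + κ * D.κrad) * D.Δ k ^ 2 := by
  obtain ⟨s, hs⟩ : ∃ s, D.trial k = D.u k + s := ⟨D.trial k - D.u k, by abel⟩
  have hsΔ : ‖s‖ ≤ D.κrad * D.Δ k := by simpa [hs] using hD.trial_mem k
  have hω := D.omega_nonneg k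
  have hΔ := (hD.Δ_pos k).le
  have hinner : |⟪∇ (D.model k) (D.u k) - ∇ f (D.u k), s⟫| ≤ κ * D.Δ k * ‖s‖ :=
    (abs_real_inner_le_norm _ _).trans (by gcongr)
  calc |D.ared e p α β f k - D.pred e p α β k|
      ≤ D.omega k * ‖s‖ ^ 2 + L * ‖s‖ ^ 2 + κ * D.Δ k * ‖s‖ := by
        rw [ared_sub_pred_eq k hs]
        refine (abs_add_le _ _).trans (add_le_add ((abs_sub _ _).trans ?_) hinner)
        exact add_le_add (abs_model_sub_le hm hsΔ) (hf.abs_sub_sub_le _ s)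
    _ ≤ D.omega k * (D.κrad * D.Δ k) ^ 2 + L * (D.κrad * D.Δ k) ^ 2 +
        κ * D.Δ k * (D.κrad * D.Δ k) := by gcongr
    _ = ((D.omega k + L) * D.κrad ^ 2 + κ * D.κrad) * D.Δ k ^ 2 := by ring

lemma exists_abs_ared_sub_pred_le (hD : D.IsRun e p α β) {L : ℝ≥0} (hf : IsLSmooth L f)
    (hgrad : D.InexactGradient e p α β f) :
    ∃ C, 0 < C ∧ ∀ k, 1 ≤ k →
      |D.ared e p α β f k - D.pred e p α β k| ≤ C * (D.b k * D.Δ k) * D.Δ k := by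
  obtain ⟨hmodel, κ, hκ, hg⟩ := hgrad
  have hκrad := hD.κrad_pos
  refine ⟨(1 + L) * D.κrad ^ 2 + κ * D.κrad, by positivity, fun k hk => ?_⟩
  obtain ⟨Lk, hLk⟩ := hmodel k
  have hb := D.one_le_b k
  calc |D.ared e p α β f k - D.pred e p α β k|
      ≤ ((D.omega k + L) * D.κrad ^ 2 + κ * D.κrad) * D.Δ k ^ 2 :=
        hD.abs_ared_sub_pred_le hf hκ hLk ((hg k).trans (by gcongr; exact min_le_right _ _))
    _ ≤ ((D.b k + L * D.b k) * D.κrad ^ 2 + κ * D.κrad * D.b k) * D.Δ k ^ 2 := by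
        have hω : D.omega k ≤ D.b k := by linarith [D.one_add_omega_le_b hk]
        have hL : (L : ℝ) ≤ L * D.b k := le_mul_of_one_le_right L.2 hb
        have hκb : κ * D.κrad ≤ κ * D.κrad * D.b k :=
          le_mul_of_one_le_right (by positivity) hb
        refine mul_le_mul_of_nonneg_right (add_le_add ?_ hκb) (sq_nonneg _)
        exact mul_le_mul_of_nonneg_right (add_le_add hω hL) (sq_nonneg _)
    _ = ((1 + L) * D.κrad ^ 2 + κ * D.κrad) * (D.b k * D.Δ k) * D.Δ k := by ring

lemma mul_Δ_le_pred (hD : D.IsRun e p α β) {k : ℕ} (hk : 1 ≤ k) {c : ℝ}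
    (hc : c ≤ D.h e p α β k) (hbΔ : D.b k * D.Δ k ≤ c) :
    D.κfcd * c * D.Δ k ≤ D.pred e p α β k := by
  have hΔ := hD.Δ_pos k
  have hκ := hD.κfcd_pos
  have hradius : D.Δ k ≤ D.h e p α β k / (1 + D.omega k) := by
    rw [le_div_iff₀ (by linarith [D.omega_nonneg k]), mul_comm]
    refine le_trans ?_ (hbΔ.trans hc)
    gcongr
    exact D.one_add_omega_le_b hk
  calc D.κfcd * c * D.Δ k ≤ D.κfcd * D.h e p α β k * D.Δ k := by gcongr
    _ = D.κfcd * D.h e p α β k * min (D.h e p α β k / (1 + D.omega k)) (D.Δ k) := by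
        rw [min_eq_right hradius]
    _ ≤ D.pred e p α β k := hD.fcd k

lemma summable_Δ (hD : D.IsRun e p α β) (hfail : ∀ᶠ k in atTop, D.rho e p α β k < D.η₁) :
    Summable D.Δ := by
  refine summable_of_ratio_norm_eventually_le hD.γ₂_lt_one ?_
  filter_upwards [hfail] with k hk
  rw [Real.norm_of_nonneg (hD.Δ_pos _).le, Real.norm_of_nonneg (hD.Δ_pos _).le]
  exact (hD.radius_unsuccessful k hk).2

lemma exists_eventually_eq (hD : D.IsRun e p α β)
    (hfail : ∀ᶠ k in atTop, D.rho e p α β k < D.η₁) : ∃ ubar, ∀ᶠ k in atTop, D.u k = ubar := by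
  obtain ⟨K, hK⟩ := eventually_atTop.1 hfail
  refine ⟨D.u K, (eventually_ge_atTop K).mono fun k hk => ?_⟩
  induction k, hk using Nat.le_induction with
  | base => rfl
  | succ k hk ih => rw [hD.reject k (hK k hk), ih]

/- Otherwise, as `Δ` is summable and `1 / b` is not, `b k * Δ k` is small for some late `k`; there
the errors of the model and of the computed reduction are small fractions of `pred k`, so iteration
`k` succeeds. -/
lemma frequently_h_lt (hD : D.IsRun e p α β) {L : ℝ≥0} (hf : IsLSmooth L f)
    (hgrad : D.InexactGradient e p α β f) (hobj : D.InexactObjective e p α β f)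
    (hb : D.CurvatureCondition) (hfail : ∀ᶠ k in atTop, D.rho e p α β k < D.η₁)
    {c : ℝ} (hc : 0 < c) : ∃ᶠ k in atTop, D.h e p α β k < c := by
  intro hlarge
  obtain ⟨C, hC, hared⟩ := hD.exists_abs_ared_sub_pred_le hf hgrad
  obtain ⟨δ, hδ, hcred⟩ := hobj.exists_tendsto_zero
  have hκ := hD.κfcd_pos
  have hη : 0 < (1 - D.η₁) / 2 := by linarith [hD.η₁_lt_η₂, hD.η₂_lt_one]
  have hsmall : 0 < min c ((1 - D.η₁) / 2 * (D.κfcd * c) / C) := lt_min hc (by positivity)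
  obtain ⟨k, hbΔ, hch, hδk, hfailk, hk⟩ := ((hb.frequently_lt (hD.summable_Δ hfail)
    hsmall).and_eventually (hlarge.and ((hδ.eventually_lt_const hη).and
      (hfail.and (eventually_ge_atTop 1))))).exists
  obtain ⟨hbΔc, hbΔC⟩ := lt_min_iff.1 hbΔ
  have hΔ := hD.Δ_pos k
  have hpred := hD.mul_Δ_le_pred hk (not_lt.1 hch) hbΔc.le
  have hpos : 0 < D.pred e p α β k := lt_of_lt_of_le (by positivity) hpred
  have hmodel : |D.ared e p α β f k - D.pred e p α β k| ≤
      (1 - D.η₁) / 2 * D.pred e p α β k := by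
    calc |D.ared e p α β f k - D.pred e p α β k| ≤ C * (D.b k * D.Δ k) * D.Δ k := hared k hk
      _ ≤ C * ((1 - D.η₁) / 2 * (D.κfcd * c) / C) * D.Δ k := by gcongr
      _ = (1 - D.η₁) / 2 * (D.κfcd * c * D.Δ k) := by field_simp
      _ ≤ (1 - D.η₁) / 2 * D.pred e p α β k := by gcongr
  linarith [one_sub_add_le_rho hpos hmodel (hcred k hpos.le)]

lemma exists_subseq_tendsto_h (hD : D.IsRun e p α β) {L : ℝ≥0} (hf : IsLSmooth L f)
    (hgrad : D.InexactGradient e p α β f) (hobj : D.InexactObjective e p α β f)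
    (hb : D.CurvatureCondition) (hfail : ∀ᶠ k in atTop, D.rho e p α β k < D.η₁) :
    ∃ σ : ℕ → ℕ, StrictMono σ ∧ Tendsto (fun n => D.h e p α β (σ n)) atTop (𝓝 0) := by
  obtain ⟨σ, hσ, hh⟩ := extraction_forall_of_frequently fun n : ℕ =>
    hD.frequently_h_lt hf hgrad hobj hb hfail (Nat.one_div_pos_of_nat (α := ℝ) (n := n))
  exact ⟨σ, hσ, squeeze_zero (fun n => hD.h_nonneg _) (fun n => (hh n).le)
    tendsto_one_div_add_atTop_nhds_zero_nat⟩

theorem exists_multiplier_self_eq (hD : D.IsRun e p α β) (hΩ : volume Ω ≠ ⊤) (hp : 0 < p)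
    (hp2 : p ≤ 2) (hα : 0 ≤ α) (hβ : 0 < β) {L : ℝ≥0} (hf : IsLSmooth L f)
    (hgrad : D.InexactGradient e p α β f) (hobj : D.InexactObjective e p α β f)
    (hb : D.CurvatureCondition) (hfin : (D.successful e p α β).Finite) :
    ∃ ubar, (∀ᶠ k in atTop, D.u k = ubar) ∧
      multiplier f α β ubar ubar = p * lpPseudo e p ubar := by
  have hfail : ∀ᶠ k in atTop, D.rho e p α β k < D.η₁ := by
    rw [← Nat.cofinite_eq_atTop]
    exact hfin.eventually_cofinite_notMem.mono fun k hk => lt_of_not_ge hk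
  obtain ⟨ubar, hubar⟩ := hD.exists_eventually_eq hfail
  obtain ⟨σ, hσ, hh⟩ := hD.exists_subseq_tendsto_h hf hgrad hobj hb hfail
  have hu : ∀ᶠ n in atTop, D.u (σ n) = ubar := hσ.tendsto_atTop.eventually hubar
  have hgradient : Tendsto (fun n => ∇ (D.model (σ n)) (D.u (σ n))) atTop (𝓝 (∇ f ubar)) := by
    have hlim := (hgrad.tendsto_gradient_sub hh).add_const (∇ f ubar)
    rw [zero_add] at hlim
    exact hlim.congr' (hu.mono fun n hn => by simp only [hn, sub_add_cancel])
  exact ⟨ubar, hubar, multiplier_self_of_tendsto e hΩ hp hp2 hα hβ hD.r₀_pos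
    (fun n => hD.ε_pos (σ n)) (hD.ε_tendsto.comp hσ.tendsto_atTop) (fun _ => rfl)
    (tendsto_prox_sub_of_tendsto_proxResidual hD.r₀_pos.ne' hh) hgradient
    (tendsto_nhds_of_eventually_eq hu)⟩

end IsRun

end Data

end TrustRegion

end SmoothedTR

end

theorem mainTheorem9_general
    {d : ℕ} {Ω : Set (SmoothedTR.Dom d)} (hΩ : volume Ω ≠ ⊤)
    {U : Type*} [NormedAddCommGroup U] [InnerProductSpace ℝ U] [CompleteSpace U]
    (e : U ≃L[ℝ] SmoothedTR.H01 Ω)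
    {p α β : ℝ} (hp : 0 < p) (hp2 : p ≤ 2) (hα : 0 ≤ α) (hβ : 0 < β)
    {f : U → ℝ} {L : ℝ≥0} (hf : SmoothedTR.IsLSmooth L f) :
    (∀ (r₀ : ℝ) (ε : ℕ → ℝ) (u P : ℕ → U) (ubar : U), 0 < r₀ →
      (∀ k, 0 < ε k) → Tendsto ε atTop (𝓝 0) →
      (∀ k, P k = SmoothedTR.prox r₀ (SmoothedTR.phiMaj e p α β (ε k) (u k))
        (u k - r₀ • ∇ f (u k))) →
      SmoothedTR.WeaklyTendsto u ubar →
      Tendsto (fun k => P k - u k) atTop (𝓝 0) →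
      Tendsto (fun k => 2 * ∫ x in Ω,
          deriv (SmoothedTR.psi p (ε k)) ((e (u k)).fn x ^ 2) * (e (P k)).fn x ^ 2)
        atTop (𝓝 (p * SmoothedTR.lpPseudo e p ubar))) ∧
    (∀ D : SmoothedTR.Data U, D.IsRun e p α β →
      D.InexactGradient e p α β f → D.InexactObjective e p α β f → D.CurvatureCondition →
      (D.successful e p α β).Finite →
      ∃ ubar : U, (∀ᶠ k in atTop, D.u k = ubar) ∧
        ∃ lam : StrongDual ℝ U,
          (∀ v : U, α * ⟪ubar, v⟫ + β * lam v = -(fderiv ℝ f ubar v)) ∧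
          lam ubar = p * SmoothedTR.lpPseudo e p ubar) ∧
    (SmoothedTR.IsCompletelyContinuous (∇ f) →
      ∀ (r₀ : ℝ) (ε : ℕ → ℝ) (u : ℕ → U) (ubar : U), 0 < r₀ →
      (∀ k, 0 < ε k) → Tendsto ε atTop (𝓝 0) →
      Tendsto (fun k => SmoothedTR.proxResidual r₀
          (SmoothedTR.phiMaj e p α β (ε k) (u k)) (∇ f (u k)) (u k)) atTop (𝓝 0) →
      SmoothedTR.WeaklyTendsto u ubar →
      ∃ lam : StrongDual ℝ U,
        (∀ v : U, α * ⟪ubar, v⟫ + β * lam v = -(fderiv ℝ f ubar v)) ∧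
        p * SmoothedTR.lpPseudo e p ubar ≤ lam ubar) := by
  refine ⟨fun r₀ ε u P ubar hr hε hε0 hP hu hPu => ?_, fun D hD hgrad hobj hb hfin => ?_,
    fun hcc r₀ ε u ubar hr hε hε0 hres hu => ?_⟩
  · obtain ⟨M, hM⟩ := hu.exists_norm_le
    have hG (k : ℕ) : ‖∇ f (u k)‖ ≤ ‖∇ f 0‖ + L * M :=
      (hf.norm_gradient_le (u k)).trans (by gcongr; exact hM k)
    exact (SmoothedTR.tendsto_psiForm_prox e hΩ hp hp2 hα hβ hr hε hε0 hP hPu hu hG).congr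
      fun k => by rw [SmoothedTR.psiForm_self]; rfl
  · obtain ⟨ubar, hubar, hself⟩ :=
      hD.exists_multiplier_self_eq hΩ hp hp2 hα hβ hf hgrad hobj hb hfin
    exact ⟨ubar, hubar, SmoothedTR.multiplier f α β ubar,
      SmoothedTR.multiplier_stationary f α hβ.ne' ubar, hself⟩
  · exact ⟨SmoothedTR.multiplier f α β ubar, SmoothedTR.multiplier_stationary f α hβ.ne' ubar,
      SmoothedTR.le_multiplier_self_of_weaklyTendsto e hΩ hp hp2 hα hβ hr hε hε0 (fun _ => rfl)
        (SmoothedTR.tendsto_prox_sub_of_tendsto_proxResidual hr.ne' hres) (hcc _ _ hu) hu⟩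

theorem mainTheorem9
    {d : ℕ} (hd : 1 ≤ d) {Ω : Set (SmoothedTR.Dom d)}
    (hΩ_open : IsOpen Ω) (hΩ_conn : IsConnected Ω) (hΩ_bdd : Bornology.IsBounded Ω)
    -- `U` is `H_0^1(Ω)` with some Hilbert inner product equivalent to the standard one
    {U : Type*} [NormedAddCommGroup U] [InnerProductSpace ℝ U] [CompleteSpace U]
    (e : U ≃L[ℝ] SmoothedTR.H01 Ω)
    {p α β : ℝ} (hp₀ : 0 < p) (hp₁ : p < 1) (hα : 0 < α) (hβ : 0 < β)
    {f : U → ℝ} {L : ℝ≥0} (hL : 0 < L) (hf : SmoothedTR.IsLSmooth L f)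
    (hF : BddBelow (Set.range fun u => f u + SmoothedTR.phi e p α β u)) :
    -- auxiliary convergence result
    (∀ (r₀ : ℝ) (ε : ℕ → ℝ) (u P : ℕ → U) (ubar : U), 0 < r₀ →
      (∀ k, 0 < ε k) → Antitone ε → Tendsto ε atTop (𝓝 0) →
      (∀ k, P k = SmoothedTR.prox r₀ (SmoothedTR.phiMaj e p α β (ε k) (u k))
        (u k - r₀ • ∇ f (u k))) →
      SmoothedTR.WeaklyTendsto u ubar →
      Tendsto (fun k => P k - u k) atTop (𝓝 0) →
      Tendsto (fun k => 2 * ∫ x in Ω,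
          deriv (SmoothedTR.psi p (ε k)) ((e (u k)).fn x ^ 2) * (e (P k)).fn x ^ 2)
        atTop (𝓝 (p * SmoothedTR.lpPseudo e p ubar))) ∧
    -- finitely many successful iterations
    (∀ D : SmoothedTR.Data U, D.IsRun e p α β →
      D.InexactGradient e p α β f → D.InexactObjective e p α β f → D.CurvatureCondition →
      (D.successful e p α β).Finite →
      ∃ ubar : U, (∀ᶠ k in atTop, D.u k = ubar) ∧
        ∃ lam : StrongDual ℝ U,
          (∀ v : U, α * ⟪ubar, v⟫ + β * lam v = -(fderiv ℝ f ubar v)) ∧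
          lam ubar = p * SmoothedTR.lpPseudo e p ubar) ∧
    -- weak accumulation points
    (SmoothedTR.IsCompletelyContinuous (∇ f) →
      ∀ (r₀ : ℝ) (ε : ℕ → ℝ) (u : ℕ → U) (σ τ : ℕ → ℕ) (ubar : U), 0 < r₀ →
      (∀ k, 0 < ε k) → Antitone ε → Tendsto ε atTop (𝓝 0) →
      StrictMono σ →
      Tendsto (fun k => SmoothedTR.proxResidual r₀
          (SmoothedTR.phiMaj e p α β (ε (σ k)) (u (σ k))) (∇ f (u (σ k))) (u (σ k)))
        atTop (𝓝 0) →
      StrictMono τ → SmoothedTR.WeaklyTendsto (fun k => u (σ (τ k))) ubar →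
      ∃ lam : StrongDual ℝ U,
        (∀ v : U, α * ⟪ubar, v⟫ + β * lam v = -(fderiv ℝ f ubar v)) ∧
        p * SmoothedTR.lpPseudo e p ubar ≤ lam ubar) := by
  obtain ⟨hweight, hfinite, hweak⟩ := mainTheorem9_general hΩ_bdd.measure_lt_top.ne e hp₀
    (by linarith) hα.le hβ hf
  exact ⟨fun r₀ ε u P ubar hr hε _ => hweight r₀ ε u P ubar hr hε, hfinite,
    fun hcc r₀ ε u σ τ ubar hr hε _ hε0 hσ hres hτ => hweak hcc r₀ (ε ∘ σ ∘ τ) (u ∘ σ ∘ τ) ubar hr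
      (fun k => hε (σ (τ k))) (hε0.comp (hσ.comp hτ).tendsto_atTop) (hres.comp hτ.tendsto_atTop)⟩
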